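/- Let $F : x^3+y^3+z^3=0$ be the Fermat cubic in $\mathbb{P}^2=\mathbb{P}^2(\mathbb{C})$. For plane curves $C,D$ and a point $p$ let $(C,D)_p$ denote the intersection multiplicity at $p$ (the dimension over $\mathbb{C}$ of the local ring of $\mathbb{P}^2$ at $p$ modulo local equations of $C$ and $D$). A smooth point $p\in C$ is an inflection point if $(C,T_pC)_p\ge 3$, where $T_pC$ is the tangent line. A point $p$ of $C$ is sextactic if it is a smooth point of $C$, it is not an inflection point, and there is a conic $Q$ (the zero set of a nonzero quadratic form) with $(C,Q)_p\ge 6$. Let $\omega$ be a primitive third root of unity, let $G$ be the group of automorphisms of $\mathbb{P}^2$ generated by $$g_1(x:y:z)=(\omega x:y:z),\qquad g_2(x:y:z)=(x:\omega y:z),$$ let $\gamma$ be a $3$-cycle in $\mathcal{S}_3$, acting on $\mathbb{P}^2$ by permuting the coordinates, and let $G'$ be the group of automorphisms of $\mathbb{P}^2$ generated by $G$ and $\gamma$. Then $G\cong\mathbb{Z}_3\times\mathbb{Z}_3$, the group $G'=G\rtimes\langle\gamma\rangle$ is the (internal) semidirect product of $G$ and $\langle\gamma\rangle$, and $|G'|=27$.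 Moreover, with $\alpha=\sqrt[3]{2}\in\mathbb{R}$, the set of sextactic points of $F$ is exactly the $G'$-orbit of the point $$s_1=(1:1:-\alpha),$$ and it consists of $27$ points. -/

import Mathlib

open scoped LinearAlgebra.Projectivization

noncomputable section

namespace PlaneCurve

/-- Points of the complex projective plane. -/
abbrev P2 : Type := ℙ ℂ (Fin 3 → ℂ)

/-- Dehomogenization of a ternary form in the affine chart where the `i`-th coordinate is `1`. -/
def dehomogenize (i : Fin 3) (f : MvPolynomial (Fin 3) ℂ) : MvPolynomial (Fin 2) ℂ :=
  MvPolynomial.aeval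
    (i.insertNth (1 : MvPolynomial (Fin 2) ℂ) MvPolynomial.X : Fin 3 → MvPolynomial (Fin 2) ℂ) f

/-- The maximal ideal of polynomials vanishing at the point `a` of the affine plane. -/
def pointIdeal (a : Fin 2 → ℂ) : Ideal (MvPolynomial (Fin 2) ℂ) :=
  RingHom.ker (MvPolynomial.eval a)

instance pointIdeal_isPrime (a : Fin 2 → ℂ) : (pointIdeal a).IsPrime :=
  RingHom.ker_isPrime (MvPolynomial.eval a)

/-- The local ring of the affine plane at the point `a`. -/
abbrev LocalRingAt (a : Fin 2 → ℂ) : Type := Localization.AtPrime (pointIdeal a)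

/-- The ideal generated by the germs of `f` and `g` in the local ring at `a`. -/
def germIdeal (f g : MvPolynomial (Fin 2) ℂ) (a : Fin 2 → ℂ) : Ideal (LocalRingAt a) :=
  Ideal.span {algebraMap (MvPolynomial (Fin 2) ℂ) (LocalRingAt a) f,
    algebraMap (MvPolynomial (Fin 2) ℂ) (LocalRingAt a) g}

/-- Intersection multiplicity at `a` of the affine plane curves `f = 0` and `g = 0`:
the dimension over `ℂ` of the local ring at `a` modulo `f` and `g` (it is `⊤` if infinite). -/
def affineIntersectionMultiplicity (f g : MvPolynomial (Fin 2) ℂ) (a : Fin 2 → ℂ) : ℕ∞ :=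
  Cardinal.toENat (Module.rank ℂ (LocalRingAt a ⧸ germIdeal f g a))

lemma exists_rep_ne_zero (p : P2) : ∃ i, p.rep i ≠ 0 :=
  Function.ne_iff.mp p.rep_nonzero

/-- The index of a standard affine chart that contains `p`. -/
def chartIndex (p : P2) : Fin 3 := (exists_rep_ne_zero p).choose

/-- The affine coordinates of `p` in the chart `chartIndex p`. -/
def affineCoords (p : P2) : Fin 2 → ℂ :=
  fun j => p.rep ((chartIndex p).succAbove j) / p.rep (chartIndex p)

/-- Intersection multiplicity `(C, D)_p` of the projective plane curves `C : f = 0` and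
`D : g = 0` at `p`, computed in an affine chart around `p` (it does not depend on the chart). -/
def intersectionMultiplicity (f g : MvPolynomial (Fin 3) ℂ) (p : P2) : ℕ∞ :=
  affineIntersectionMultiplicity (dehomogenize (chartIndex p) f) (dehomogenize (chartIndex p) g)
    (affineCoords p)

/-- `p` is a smooth point of the curve `f = 0` (`f` a form). -/
def IsSmoothPoint (f : MvPolynomial (Fin 3) ℂ) (p : P2) : Prop :=
  MvPolynomial.eval p.rep f = 0 ∧ ∃ i, MvPolynomial.eval p.rep (MvPolynomial.pderiv i f) ≠ 0

/-- The linear form `x f_x(p) + y f_y(p) + z f_z(p)` that defines the tangent line `T_p C` of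
`C : f = 0` at a smooth point `p`. -/
def tangentLine (f : MvPolynomial (Fin 3) ℂ) (p : P2) : MvPolynomial (Fin 3) ℂ :=
  ∑ i, MvPolynomial.C (MvPolynomial.eval p.rep (MvPolynomial.pderiv i f)) * MvPolynomial.X i

/-- `p` is an inflection point of `C : f = 0`: a smooth point with `(C, T_p C)_p ≥ 3`. -/
def IsInflectionPoint (f : MvPolynomial (Fin 3) ℂ) (p : P2) : Prop :=
  IsSmoothPoint f p ∧ 3 ≤ intersectionMultiplicity f (tangentLine f p) p

/-- `q = 0` is a conic (possibly reducible). -/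
def IsConic (q : MvPolynomial (Fin 3) ℂ) : Prop :=
  q.IsHomogeneous 2 ∧ q ≠ 0

/-- `p` is a sextactic point of `C : f = 0`: it is a smooth point which is not an inflection point
and some conic `Q` has `(C, Q)_p ≥ 6`. At a smooth non-inflection point of an irreducible curve of
degree at least `3` there is exactly one conic with `(C, Q)_p ≥ 5`, so this says that this
osculating conic hyperosculates. Inflection points have to be excluded: the doubled inflectional
tangent meets `C` there with multiplicity at least `6`. -/
def IsSextacticPoint (f : MvPolynomial (Fin 3) ℂ) (p : P2) : Prop :=
  IsSmoothPoint f p ∧ ¬ IsInflectionPoint f p ∧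
    ∃ q, IsConic q ∧ 6 ≤ intersectionMultiplicity f q p

/-- The Fermat cubic `x ^ 3 + y ^ 3 + z ^ 3`. -/
def fermatCubic : MvPolynomial (Fin 3) ℂ :=
  MvPolynomial.X 0 ^ 3 + MvPolynomial.X 1 ^ 3 + MvPolynomial.X 2 ^ 3

/-- The automorphism group of the projective plane. -/
abbrev PGL3 : Type := Matrix.ProjGenLinGroup (Fin 3) ℂ

/-- The invertible diagonal matrix with diagonal entries `d`. -/
def diagonalGL (d : Fin 3 → ℂˣ) : GL (Fin 3) ℂ where
  val := Matrix.diagonal fun i => (d i : ℂ)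
  inv := Matrix.diagonal fun i => ((d i)⁻¹ : ℂˣ)
  val_inv := by simp [Matrix.diagonal_mul_diagonal]
  inv_val := by simp [Matrix.diagonal_mul_diagonal]

/-- The automorphism `(x : y : z) ↦ (ω x : y : z)`. -/
def g₁ (ω : ℂˣ) : PGL3 := Matrix.ProjGenLinGroup.mk (diagonalGL ![ω, 1, 1])

/-- The automorphism `(x : y : z) ↦ (x : ω y : z)`. -/
def g₂ (ω : ℂˣ) : PGL3 := Matrix.ProjGenLinGroup.mk (diagonalGL ![1, ω, 1])

/-- The automorphism of the plane that permutes the coordinates by `σ`. -/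
def permAut (σ : Equiv.Perm (Fin 3)) : PGL3 :=
  Matrix.ProjGenLinGroup.mk ((Matrix.permMatrixHom (n := Fin 3) (R := ℂ)).toHomUnits σ)

/-- The group `G` generated by `g₁` and `g₂`. -/
def groupG (ω : ℂˣ) : Subgroup PGL3 := Subgroup.closure {g₁ ω, g₂ ω}

/-- The group `G'` generated by `G` and the coordinate permutation `γ`. -/
def groupG' (ω : ℂˣ) (γ : Equiv.Perm (Fin 3)) : Subgroup PGL3 :=
  groupG ω ⊔ Subgroup.zpowers (permAut γ)

lemma one_one_neg_ne_zero (α : ℂ) : (![1, 1, -α] : Fin 3 → ℂ) ≠ 0 :=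
  fun h => one_ne_zero (congrFun h 0)

/-- The point `(1 : 1 : -α)`. -/
def s₁ (α : ℂ) : P2 := Projectivization.mk ℂ ![1, 1, -α] (one_one_neg_ne_zero α)

end PlaneCurve

end

namespace PlaneCurve

/-! Contact with a curve at a smooth point is an order of vanishing along a parametrization. The
lower bound `le_affineIntersectionMultiplicity` needs only a formal arc with a uniformizer that
meets both curves to order `n`. The upper bound `X_pow_dvd_of_le_affineIntersectionMultiplicity`
needs an arc lying on the first curve, whose local ring there has a principal maximal ideal.

At a point `a` of `x³ + y³ + 1 = 0` off the axes, the arc `(a₀(1 + a₁³t)^(1/3), a₁(1 - a₀³t)^(1/3))`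
lies on the curve. With `P = a₁³` and `Q = -a₀³`, contact of order six with a conic becomes six
linear equations in its six rescaled coefficients (`X_pow_six_dvd_conic_iff`). They have a nonzero
solution exactly when `(P + Q)(P - 2Q)(2P - Q) = 0`. Since `P - Q = -1`, this says that two of
`a₀³`, `a₁³`, `1` coincide. Off the axes the tangent has contact less than three, while the points
on the axes are inflection points. So a point of the cubic is sextactic iff no coordinate vanishes
and two coordinates have equal cubes (`isSextacticPoint_fermatCubic_iff_rep`).

The cube of the remaining coordinate is then `-2` times the common one, so the point is `(1 : 1 :
-α)` up to cube roots of unity on the coordinates and the position of the exceptional coordinate.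
The former are supplied by `G`, the 3-torsion of the diagonal torus modulo scalars, and the latter
by the powers of `γ`, which permute the three positions simply transitively. Hence there is one
orbit with trivial stabilizer, of size `9 · 3 = 27`. -/

/-! ### Intersection multiplicities computed along formal arcs. -/

open PowerSeries in
lemma isUnit_aeval_of_mem_primeCompl {a : Fin 2 → ℂ} {w : Fin 2 → ℂ⟦X⟧}
    (hw : ∀ i, constantCoeff (w i) = a i) (s : (pointIdeal a).primeCompl) :
    IsUnit (MvPolynomial.aeval w (s : MvPolynomial (Fin 2) ℂ)) := by
  have h : ∀ p : MvPolynomial (Fin 2) ℂ,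
      constantCoeff (MvPolynomial.aeval w p) = MvPolynomial.eval a p := by
    intro p
    induction p using MvPolynomial.induction_on with
    | C c => simp
    | add p q hp hq => simp [hp, hq]
    | mul_X p i hp => simp [hp, hw]
  rw [PowerSeries.isUnit_iff_constantCoeff, h]
  exact isUnit_iff_ne_zero.mpr fun h0 => s.2 h0

/-- The expansion of germs at `a` along the formal arc `w` through `a`. -/
noncomputable def arcExpansion {a : Fin 2 → ℂ} (w : Fin 2 → PowerSeries ℂ)
    (hw : ∀ i, PowerSeries.constantCoeff (w i) = a i) : LocalRingAt a →ₐ[ℂ] PowerSeries ℂ :=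
  IsLocalization.liftAlgHom (M := (pointIdeal a).primeCompl) (f := MvPolynomial.aeval w)
    (isUnit_aeval_of_mem_primeCompl hw)

lemma arcExpansion_algebraMap {a : Fin 2 → ℂ} (w : Fin 2 → PowerSeries ℂ)
    (hw : ∀ i, PowerSeries.constantCoeff (w i) = a i) (p : MvPolynomial (Fin 2) ℂ) :
    arcExpansion w hw (algebraMap _ _ p) = MvPolynomial.aeval w p := by
  simp [arcExpansion]

lemma natCast_le_affineIntersectionMultiplicity_iff {f g : MvPolynomial (Fin 2) ℂ}
    {a : Fin 2 → ℂ} {n : ℕ} : (n : ℕ∞) ≤ affineIntersectionMultiplicity f g a ↔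
      (n : Cardinal) ≤ Module.rank ℂ (LocalRingAt a ⧸ germIdeal f g a) :=
  Cardinal.natCast_le_toENat

/-- As `δ` is a unit, `(X δ) ^ i` has order exactly `i`, so the first nonzero `c i` would survive as
the coefficient of `X ^ i`. -/
lemma coeff_eq_zero_of_X_pow_dvd_sum {n : ℕ} {δ : PowerSeries ℂ}
    (hδ : PowerSeries.constantCoeff δ ≠ 0) (c : ℕ → ℂ)
    (h : PowerSeries.X ^ n ∣ ∑ i ∈ Finset.range n, c i • (PowerSeries.X * δ) ^ i) :
    ∀ i < n, c i = 0 := by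
  intro i
  induction i using Nat.strong_induction_on with
  | _ i ih =>
    intro hi
    have h1 := PowerSeries.X_pow_dvd_iff.mp h i hi
    rw [map_sum, Finset.sum_eq_single i] at h1
    · simpa [mul_pow, PowerSeries.coeff_X_pow_mul', hδ] using h1
    · intro j hj hji
      rcases lt_or_gt_of_ne hji with hlt | hgt
      · simp [ih j hlt (hlt.trans hi)]
      · simp [mul_pow, PowerSeries.coeff_X_pow_mul', hgt]
    · simp [hi]

/-- If an arc with a uniformizer `τ` meets both curves to order `n`, the curves meet with
multiplicity at least `n`. -/
lemma le_affineIntersectionMultiplicity {f g : MvPolynomial (Fin 2) ℂ} {a : Fin 2 → ℂ} {n : ℕ}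
    (w : Fin 2 → PowerSeries ℂ) (hw : ∀ i, PowerSeries.constantCoeff (w i) = a i)
    (τ : MvPolynomial (Fin 2) ℂ) {δ : PowerSeries ℂ} (hδ : PowerSeries.constantCoeff δ ≠ 0)
    (hτ : MvPolynomial.aeval w τ = PowerSeries.X * δ)
    (hf : PowerSeries.X ^ n ∣ MvPolynomial.aeval w f)
    (hg : PowerSeries.X ^ n ∣ MvPolynomial.aeval w g) :
    (n : ℕ∞) ≤ affineIntersectionMultiplicity f g a := by
  rw [natCast_le_affineIntersectionMultiplicity_iff]
  set I := germIdeal f g a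
  set t : LocalRingAt a := algebraMap _ _ τ
  have hI : ∀ b ∈ I, PowerSeries.X ^ n ∣ arcExpansion w hw b := by
    intro b hb
    obtain ⟨x, y, rfl⟩ := Ideal.mem_span_pair.mp hb
    rw [map_add, map_mul, map_mul, arcExpansion_algebraMap, arcExpansion_algebraMap]
    exact dvd_add (hf.mul_left _) (hg.mul_left _)
  -- A relation among the powers of `t` modulo `I` pulls back along the arc to a combination of the
  -- `(X δ) ^ i` divisible by `X ^ n`.
  have hli : LinearIndependent ℂ fun i : Fin n => (Ideal.Quotient.mk I t) ^ (i : ℕ) := by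
    rw [Fintype.linearIndependent_iff]
    intro c hc
    let c' : ℕ → ℂ := fun i => if h : i < n then c ⟨i, h⟩ else 0
    have hcc : ∀ i : Fin n, c i = c' i := fun i => by simp [c']
    simp only [hcc] at hc ⊢
    rw [Fin.sum_univ_eq_sum_range (fun i => c' i • (Ideal.Quotient.mk I t) ^ i) n] at hc
    have hmem : ∑ i ∈ Finset.range n, c' i • t ^ i ∈ I := by
      rw [← Ideal.Quotient.eq_zero_iff_mem, map_sum]
      rw [← hc]
      refine Finset.sum_congr rfl fun i _ => ?_
      rw [← map_pow (Ideal.Quotient.mk I)]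
      rfl
    have := hI _ hmem
    simp only [map_sum, map_smul, map_pow, t, arcExpansion_algebraMap, hτ] at this
    intro i
    exact coeff_eq_zero_of_X_pow_dvd_sum hδ c' this i i.2
  simpa using hli.cardinal_le_rank

/-- First-order Taylor expansion: the two coordinate differences generate the maximal ideal of the
point. -/
lemma exists_eq_C_add_mul_add_mul (a : Fin 2 → ℂ) (h : MvPolynomial (Fin 2) ℂ) :
    ∃ r s, h = MvPolynomial.C (MvPolynomial.eval a h) +
      (MvPolynomial.X 0 - MvPolynomial.C (a 0)) * r +
      (MvPolynomial.X 1 - MvPolynomial.C (a 1)) * s := by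
  induction h using MvPolynomial.induction_on with
  | C c => exact ⟨0, 0, by simp⟩
  | add p q hp hq =>
    obtain ⟨r, s, h⟩ := hp
    obtain ⟨r', s', h'⟩ := hq
    refine ⟨r + r', s + s', ?_⟩
    conv_lhs => rw [h, h']
    simp only [map_add]
    ring
  | mul_X p i hp =>
    obtain ⟨r, s, h⟩ := hp
    fin_cases i
    · refine ⟨r * MvPolynomial.X 0 + MvPolynomial.C (MvPolynomial.eval a p),
        s * MvPolynomial.X 0, ?_⟩
      conv_lhs => rw [h]
      simp only [map_mul, MvPolynomial.eval_X, Fin.zero_eta, Fin.isValue]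
      ring
    · refine ⟨r * MvPolynomial.X 1,
        s * MvPolynomial.X 1 + MvPolynomial.C (MvPolynomial.eval a p), ?_⟩
      conv_lhs => rw [h]
      simp only [map_mul, MvPolynomial.eval_X, Fin.mk_one, Fin.isValue]
      ring

/-- At a point where `f = 0` has a non-vertical tangent, `x - a₀` generates the maximal ideal of
the local ring modulo `f`. -/
lemma exists_eq_const_add_uniformizer_mul {f : MvPolynomial (Fin 2) ℂ} {a : Fin 2 → ℂ}
    {r s : MvPolynomial (Fin 2) ℂ}
    (hf : f = (MvPolynomial.X 0 - MvPolynomial.C (a 0)) * r +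
      (MvPolynomial.X 1 - MvPolynomial.C (a 1)) * s) (hs : MvPolynomial.eval a s ≠ 0)
    (b : LocalRingAt a) : ∃ (c : ℂ) (b' e : LocalRingAt a), b = algebraMap ℂ _ c +
      algebraMap (MvPolynomial (Fin 2) ℂ) _ (MvPolynomial.X 0 - MvPolynomial.C (a 0)) * b' + algebraMap _ _ f * e := by
  obtain ⟨p, q, rfl⟩ := IsLocalization.exists_mk'_eq (pointIdeal a).primeCompl b
  have hq0 : MvPolynomial.eval a (q : MvPolynomial (Fin 2) ℂ) ≠ 0 := fun h0 => q.2 h0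
  set c : ℂ := MvPolynomial.eval a p / MvPolynomial.eval a (q : MvPolynomial (Fin 2) ℂ) with hc
  obtain ⟨r', s', h⟩ := exists_eq_C_add_mul_add_mul a (p - MvPolynomial.C c * (q : MvPolynomial (Fin 2) ℂ))
  have h0 : MvPolynomial.eval a (p - MvPolynomial.C c * (q : MvPolynomial (Fin 2) ℂ)) = 0 := by
    simp [hc, hq0]
  rw [h0, map_zero, zero_add] at h
  have hsu : IsUnit (algebraMap (MvPolynomial (Fin 2) ℂ) (LocalRingAt a) s) :=
    IsLocalization.map_units _ (⟨s, fun h => hs h⟩ : (pointIdeal a).primeCompl)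
  have hqu : IsUnit (algebraMap (MvPolynomial (Fin 2) ℂ) (LocalRingAt a) q) :=
    IsLocalization.map_units _ q
  obtain ⟨σ, hσ⟩ := hsu.exists_right_inv
  obtain ⟨κ, hκ⟩ := hqu.exists_right_inv
  have hmk : IsLocalization.mk' (LocalRingAt a) p q = algebraMap _ _ p * κ := by
    rw [IsLocalization.mk'_eq_iff_eq_mul]
    linear_combination (-algebraMap _ (LocalRingAt a) p) * hκ
  have hC : algebraMap (MvPolynomial (Fin 2) ℂ) (LocalRingAt a) (MvPolynomial.C c) =
      algebraMap ℂ _ c := by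
    rw [← MvPolynomial.algebraMap_eq, ← IsScalarTower.algebraMap_apply]
  have h' := congrArg (algebraMap _ (LocalRingAt a)) h
  have hf' := congrArg (algebraMap _ (LocalRingAt a)) hf
  simp only [map_sub, map_add, map_mul, hC] at h' hf' ⊢
  -- Since `s` is a unit at `a`, the equation of `f` expresses `y - a₁` as `σ (f - (x - a₀) r)`;
  -- substitute this into the expansion of `p - c q` and divide by `q`.
  refine ⟨c, (algebraMap _ _ r' - algebraMap _ _ r * σ * algebraMap _ _ s') * κ,
    σ * algebraMap _ _ s' * κ, ?_⟩
  rw [hmk]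
  linear_combination κ * h' - σ * algebraMap _ _ s' * κ * hf' + algebraMap ℂ _ c * hκ -
    (algebraMap (MvPolynomial (Fin 2) ℂ) (LocalRingAt a) (MvPolynomial.X 1) -
        algebraMap (MvPolynomial (Fin 2) ℂ) (LocalRingAt a) (MvPolynomial.C (a 1))) *
      algebraMap _ _ s' * κ * hσ

open PowerSeries in
/-- A germ of order at least `k` along a smooth branch of `f = 0` is divisible by the `k`-th power
of the uniformizer modulo `f`. -/
lemma exists_eq_uniformizer_pow_mul {f : MvPolynomial (Fin 2) ℂ} {a : Fin 2 → ℂ}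
    (w : Fin 2 → ℂ⟦X⟧) (hw : ∀ i, constantCoeff (w i) = a i) {t : LocalRingAt a}
    (ht : ∀ b : LocalRingAt a, ∃ (c : ℂ) (b' e : LocalRingAt a),
      b = algebraMap ℂ _ c + t * b' + algebraMap _ _ f * e)
    {δ : ℂ⟦X⟧} (hδ : constantCoeff δ ≠ 0) (hτ : arcExpansion w hw t = X * δ)
    (hf : MvPolynomial.aeval w f = 0) (b : LocalRingAt a) (k : ℕ)
    (hb : X ^ k ∣ arcExpansion w hw b) :
    ∃ b' e : LocalRingAt a, b = t ^ k * b' + algebraMap _ _ f * e := by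
  induction k with
  | zero => exact ⟨b, 0, by simp⟩
  | succ k ih =>
    obtain ⟨b', e, h⟩ := ih ((pow_dvd_pow _ k.le_succ).trans hb)
    obtain ⟨c, b'', e', h'⟩ := ht b'
    rw [h, h'] at hb
    simp only [map_add, map_mul, map_pow, arcExpansion_algebraMap, hf, hτ, AlgHom.commutes,
      zero_mul, add_zero] at hb
    rw [mul_pow, mul_assoc, pow_succ, mul_dvd_mul_iff_left (pow_ne_zero _ X_ne_zero),
      X_dvd_iff] at hb
    -- After cancelling `X ^ k`, the constant term is `c` times a power of the nonzero constant term
    -- of `δ`.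
    have hc : c = 0 := by simpa [hδ, PowerSeries.algebraMap_apply] using hb
    refine ⟨b'', e + t ^ k * e', ?_⟩
    rw [h, h', hc, map_zero]
    ring

open PowerSeries in
/-- Upper bound for the intersection multiplicity from a parametrization of a smooth branch. -/
lemma X_pow_dvd_of_le_affineIntersectionMultiplicity {f g : MvPolynomial (Fin 2) ℂ}
    {a : Fin 2 → ℂ} {n : ℕ} (w : Fin 2 → ℂ⟦X⟧) (hw : ∀ i, constantCoeff (w i) = a i)
    {r s : MvPolynomial (Fin 2) ℂ}
    (hfa : f = (MvPolynomial.X 0 - MvPolynomial.C (a 0)) * r +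
      (MvPolynomial.X 1 - MvPolynomial.C (a 1)) * s) (hs : MvPolynomial.eval a s ≠ 0)
    {δ : ℂ⟦X⟧} (hδ : constantCoeff δ ≠ 0)
    (hτ : MvPolynomial.aeval w (MvPolynomial.X 0 - MvPolynomial.C (a 0)) = X * δ)
    (hf : MvPolynomial.aeval w f = 0) (hn : (n : ℕ∞) ≤ affineIntersectionMultiplicity f g a) :
    X ^ n ∣ MvPolynomial.aeval w g := by
  classical
  rw [natCast_le_affineIntersectionMultiplicity_iff] at hn
  have ht := exists_eq_const_add_uniformizer_mul hfa hs
  set t : LocalRingAt a := algebraMap (MvPolynomial (Fin 2) ℂ) _ (MvPolynomial.X 0 - MvPolynomial.C (a 0)) with htdef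
  rw [← arcExpansion_algebraMap w hw, ← htdef] at hτ
  -- If `g` had order exactly `m < n` along the branch, then `g` would be a unit times `t ^ m`
  -- modulo `f`, and the quotient would have dimension at most `m`.
  have step : ∀ m < n, X ^ m ∣ MvPolynomial.aeval w g → X ^ (m + 1) ∣ MvPolynomial.aeval w g := by
    intro m hm hdvd
    by_contra hcon
    obtain ⟨b, e, hb⟩ := exists_eq_uniformizer_pow_mul w hw ht hδ hτ hf (algebraMap _ _ g) m
      (by rwa [arcExpansion_algebraMap])
    obtain ⟨c, b', e', hb'⟩ := ht b
    have hc : c ≠ 0 := by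
      rintro rfl
      apply hcon
      rw [← arcExpansion_algebraMap w hw, hb, hb']
      simp only [map_add, map_mul, map_pow, arcExpansion_algebraMap, hf, hτ, map_zero,
        zero_mul, add_zero, zero_add]
      exact ⟨δ ^ m * (δ * arcExpansion w hw b'), by ring⟩
    have hunit : IsUnit (algebraMap ℂ (LocalRingAt a) c + t * b') := by
      have htm : t ∈ IsLocalRing.maximalIdeal (LocalRingAt a) := by
        rw [htdef]
        exact (IsLocalization.AtPrime.to_map_mem_maximal_iff _ (pointIdeal a) _).mpr (by
          simp [pointIdeal, RingHom.mem_ker])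
      by_contra hnu
      have h1 : algebraMap ℂ (LocalRingAt a) c + t * b' ∈
        IsLocalRing.maximalIdeal (LocalRingAt a) := hnu
      have h2 := (Ideal.add_mem_iff_left _ (Ideal.mul_mem_right b' _ htm)).mp h1
      exact h2 ((isUnit_iff_ne_zero.mpr hc).map _)
    set I := germIdeal f g a with hI
    have hfI : algebraMap _ _ f ∈ I := Ideal.subset_span (by simp)
    have hgI : algebraMap _ _ g ∈ I := Ideal.subset_span (by simp)
    have htI : t ^ m ∈ I := by
      rw [← Ideal.mul_unit_mem_iff_mem _ hunit]
      have : t ^ m * (algebraMap ℂ (LocalRingAt a) c + t * b') =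
          algebraMap _ _ g - (t ^ m * e' + e) * algebraMap _ _ f := by
        rw [hb, hb']; ring
      rw [this]
      exact I.sub_mem hgI (I.mul_mem_left _ hfI)
    -- Iterating `ht` gives a `t`-adic expansion with remainder; at `k = m` the remainder dies
    -- because `t ^ m ∈ I`.
    have hspan : ∀ k, ∀ b : LocalRingAt a, ∃ b'' : LocalRingAt a,
        Ideal.Quotient.mk I (b - t ^ k * b'') ∈ Submodule.span ℂ
          (((Finset.range k).image fun i => Ideal.Quotient.mk I t ^ i :
            Finset (LocalRingAt a ⧸ I)) : Set (LocalRingAt a ⧸ I)) := by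
      intro k
      induction k with
      | zero => exact fun b => ⟨b, by simp⟩
      | succ k ih =>
        intro b
        obtain ⟨b₁, h₁⟩ := ih b
        obtain ⟨c, b₂, e, h₂⟩ := ht b₁
        refine ⟨b₂, ?_⟩
        have : Ideal.Quotient.mk I (b - t ^ (k + 1) * b₂) =
            Ideal.Quotient.mk I (b - t ^ k * b₁) + c • Ideal.Quotient.mk I t ^ k := by
          have h3 : b - t ^ (k + 1) * b₂ =
              (b - t ^ k * b₁) + c • t ^ k + (t ^ k * e) * algebraMap _ _ f := by
            rw [Algebra.smul_def, h₂]; ring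
          rw [h3, map_add, Ideal.Quotient.eq_zero_iff_mem.mpr (I.mul_mem_left _ hfI), add_zero,
            map_add, ← map_pow (Ideal.Quotient.mk I)]
          rfl
        rw [this]
        refine Submodule.add_mem _ (Submodule.span_mono ?_ h₁) (Submodule.smul_mem _ _ ?_)
        · exact_mod_cast Finset.image_subset_image (Finset.range_mono k.le_succ)
        · exact Submodule.subset_span (by
            rw [Finset.mem_coe]
            exact Finset.mem_image_of_mem _ (Finset.self_mem_range_succ k))
    have htop : Submodule.span ℂ
        (((Finset.range m).image fun i => Ideal.Quotient.mk I t ^ i :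
          Finset (LocalRingAt a ⧸ I)) : Set (LocalRingAt a ⧸ I)) = ⊤ := by
      rw [eq_top_iff]
      rintro x -
      obtain ⟨b, rfl⟩ := Ideal.Quotient.mk_surjective x
      obtain ⟨b'', h⟩ := hspan m b
      rwa [map_sub, Ideal.Quotient.eq_zero_iff_mem.mpr (I.mul_mem_right _ htI), sub_zero] at h
    have hle := rank_span_finset_le (R := ℂ)
      ((Finset.range m).image fun i => Ideal.Quotient.mk I t ^ i)
    rw [htop, rank_top] at hle
    have := (hn.trans hle)
    rw [Nat.cast_le] at this
    have := this.trans Finset.card_image_le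
    rw [Finset.card_range] at this
    omega
  have : ∀ m ≤ n, X ^ m ∣ MvPolynomial.aeval w g := by
    intro m
    induction m with
    | zero => simp
    | succ m ih => exact fun hm => step m hm (ih (by omega))
  exact this n le_rfl

/-! ### The cube-root branch of the affine Fermat cubic and its osculating conics. -/

section FermatBranch

open PowerSeries

lemma binomialSeries_third_pow_three :
    PowerSeries.binomialSeries ℂ (1 / 3 : ℚ) ^ 3 = 1 + X := by
  rw [pow_three, ← binomialSeries_add, ← binomialSeries_add]
  have := binomialSeries_nat (R := ℚ) (A := ℂ) 1
  norm_num at this ⊢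
  exact this

lemma binomialSeries_third_sq :
    PowerSeries.binomialSeries ℂ (1 / 3 : ℚ) ^ 2 = PowerSeries.binomialSeries ℂ (2 / 3 : ℚ) := by
  rw [pow_two, ← binomialSeries_add]
  norm_num

lemma coeff_binomialSeries_third (n : ℕ) : coeff n (PowerSeries.binomialSeries ℂ (1 / 3 : ℚ)) =
    ((Ring.choose (1 / 3 : ℚ) n : ℚ) : ℂ) := by
  simp [Rat.smul_def]

lemma coeff_binomialSeries_two_thirds (n : ℕ) : coeff n (PowerSeries.binomialSeries ℂ (2 / 3 : ℚ)) =
    ((Ring.choose (2 / 3 : ℚ) n : ℚ) : ℂ) := by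
  simp [Rat.smul_def]

lemma choose_third : Ring.choose (1 / 3 : ℚ) 0 = 1 ∧ Ring.choose (1 / 3 : ℚ) 1 = 1 / 3 ∧
    Ring.choose (1 / 3 : ℚ) 2 = -1 / 9 ∧ Ring.choose (1 / 3 : ℚ) 3 = 5 / 81 ∧
    Ring.choose (1 / 3 : ℚ) 4 = -10 / 243 ∧ Ring.choose (1 / 3 : ℚ) 5 = 22 / 729 := by
  refine ⟨?_, ?_, ?_, ?_, ?_, ?_⟩ <;>
    rw [Ring.choose_eq_smul] <;>
    simp only [descPochhammer_succ_right, descPochhammer_zero, Polynomial.smeval_mul,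
      Polynomial.smeval_sub, Polynomial.smeval_X, Polynomial.smeval_natCast,
      Polynomial.smeval_one] <;>
    norm_num [Nat.factorial]

lemma choose_two_thirds : Ring.choose (2 / 3 : ℚ) 0 = 1 ∧ Ring.choose (2 / 3 : ℚ) 1 = 2 / 3 ∧
    Ring.choose (2 / 3 : ℚ) 2 = -1 / 9 ∧ Ring.choose (2 / 3 : ℚ) 3 = 4 / 81 ∧
    Ring.choose (2 / 3 : ℚ) 4 = -7 / 243 ∧ Ring.choose (2 / 3 : ℚ) 5 = 14 / 729 := by
  refine ⟨?_, ?_, ?_, ?_, ?_, ?_⟩ <;>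
    rw [Ring.choose_eq_smul] <;>
    simp only [descPochhammer_succ_right, descPochhammer_zero, Polynomial.smeval_mul,
      Polynomial.smeval_sub, Polynomial.smeval_X, Polynomial.smeval_natCast,
      Polynomial.smeval_one] <;>
    norm_num [Nat.factorial]

/-- The power series expansion of `(1 + P t) ^ (1 / 3)`. -/
noncomputable def cubeRootSeries (P : ℂ) : ℂ⟦X⟧ := rescale P (PowerSeries.binomialSeries ℂ (1 / 3 : ℚ))

lemma cubeRootSeries_pow_three (P : ℂ) : cubeRootSeries P ^ 3 = 1 + C P * X := by
  rw [cubeRootSeries, ← map_pow, binomialSeries_third_pow_three, map_add, map_one, rescale_X]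

lemma coeff_cubeRootSeries (P : ℂ) (n : ℕ) :
    coeff n (cubeRootSeries P) = P ^ n * (Ring.choose (1 / 3 : ℚ) n : ℚ) := by
  rw [cubeRootSeries, coeff_rescale, coeff_binomialSeries_third]

lemma coeff_cubeRootSeries_sq (P : ℂ) (n : ℕ) :
    coeff n (cubeRootSeries P ^ 2) = P ^ n * (Ring.choose (2 / 3 : ℚ) n : ℚ) := by
  rw [cubeRootSeries, ← map_pow, binomialSeries_third_sq, coeff_rescale,
    coeff_binomialSeries_two_thirds]

@[simp]
lemma constantCoeff_cubeRootSeries (P : ℂ) : constantCoeff (cubeRootSeries P) = 1 := by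
  rw [← coeff_zero_eq_constantCoeff_apply, coeff_cubeRootSeries, choose_third.1]
  simp

/-- For `P ≠ 0` this makes the first coordinate of the branch, minus its value at the point, a
uniformizer of the arc. -/
lemma exists_cubeRootSeries_eq (P : ℂ) :
    ∃ δ : ℂ⟦X⟧, constantCoeff δ = P / 3 ∧ cubeRootSeries P = 1 + X * δ := by
  refine ⟨PowerSeries.mk fun n => coeff (n + 1) (cubeRootSeries P), ?_, ?_⟩
  · rw [← coeff_zero_eq_constantCoeff_apply, coeff_mk, coeff_cubeRootSeries, zero_add,
      choose_third.2.1]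
    push_cast
    ring
  · have := eq_X_mul_shift_add_const (cubeRootSeries P)
    rw [constantCoeff_cubeRootSeries, map_one] at this
    rw [add_comm]
    exact this

/-- Vanishing to order six of a conic along the branch `((1 + P t) ^ (1/3), (1 + Q t) ^ (1/3))`,
as linear equations in its coefficients. -/
lemma X_pow_six_dvd_conic_iff (P Q k₀ k₁ k₂ k₃ k₄ k₅ : ℂ) :
    X ^ 6 ∣ C k₀ + C k₁ * cubeRootSeries P + C k₂ * cubeRootSeries Q +
      C k₃ * cubeRootSeries P ^ 2 + C k₄ * (cubeRootSeries P * cubeRootSeries Q) +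
      C k₅ * cubeRootSeries Q ^ 2 ↔
    k₀ + k₁ + k₂ + k₃ + k₄ + k₅ = 0 ∧
    k₁ * P + k₂ * Q + 2 * k₃ * P + k₄ * (P + Q) + 2 * k₅ * Q = 0 ∧
    -k₁ * P ^ 2 - k₂ * Q ^ 2 - k₃ * P ^ 2 + k₄ * (P * Q - P ^ 2 - Q ^ 2) - k₅ * Q ^ 2 = 0 ∧
    5 * k₁ * P ^ 3 + 5 * k₂ * Q ^ 3 + 4 * k₃ * P ^ 3 +
      k₄ * (5 * P ^ 3 - 3 * P ^ 2 * Q - 3 * P * Q ^ 2 + 5 * Q ^ 3) + 4 * k₅ * Q ^ 3 = 0 ∧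
    -10 * k₁ * P ^ 4 - 10 * k₂ * Q ^ 4 - 7 * k₃ * P ^ 4 +
      k₄ * (-10 * P ^ 4 + 5 * P ^ 3 * Q + 3 * P ^ 2 * Q ^ 2 + 5 * P * Q ^ 3 - 10 * Q ^ 4) -
      7 * k₅ * Q ^ 4 = 0 ∧
    22 * k₁ * P ^ 5 + 22 * k₂ * Q ^ 5 + 14 * k₃ * P ^ 5 +
      k₄ * (22 * P ^ 5 - 10 * P ^ 4 * Q - 5 * P ^ 3 * Q ^ 2 - 5 * P ^ 2 * Q ^ 3 -
        10 * P * Q ^ 4 + 22 * Q ^ 5) + 14 * k₅ * Q ^ 5 = 0 := by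
  obtain ⟨a0, a1, a2, a3, a4, a5⟩ := choose_third
  obtain ⟨d0, d1, d2, d3, d4, d5⟩ := choose_two_thirds
  -- Clears the denominators of the binomial coefficients, one factor per order.
  have key : ∀ (c e e' : ℂ), c ≠ 0 → e = c * e' → (e = 0 ↔ e' = 0) := by
    rintro c e e' hc rfl
    simp [hc]
  rw [X_pow_dvd_iff]
  simp only [Nat.forall_lt_succ_right, not_lt_zero, IsEmpty.forall_iff, implies_true, true_and,
    map_add, coeff_C_mul, coeff_cubeRootSeries_sq, coeff_C, coeff_mul _ (cubeRootSeries P),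
    coeff_cubeRootSeries, Finset.Nat.sum_antidiagonal_eq_sum_range_succ_mk, Finset.sum_range_succ,
    Finset.sum_range_zero, and_assoc, zero_add, Nat.reduceSub]
  simp only [a0, a1, a2, a3, a4, a5, d0, d1, d2, d3, d4, d5]
  refine and_congr (key 1 _ _ (by norm_num) ?_) <| and_congr (key (1 / 3) _ _ (by norm_num) ?_) <|
    and_congr (key (1 / 9) _ _ (by norm_num) ?_) <|
    and_congr (key (1 / 81) _ _ (by norm_num) ?_) <|
    and_congr (key (1 / 243) _ _ (by norm_num) ?_) (key (1 / 729) _ _ (by norm_num) ?_)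
  all_goals
    push_cast
    ring

/-- The Fermat cubic in an affine chart. -/
noncomputable def affineFermatCubic : MvPolynomial (Fin 2) ℂ :=
  MvPolynomial.X 0 ^ 3 + MvPolynomial.X 1 ^ 3 + 1

/-- The parametrization of the Fermat cubic near `a` by cube roots. -/
noncomputable def fermatBranch (a : Fin 2 → ℂ) : Fin 2 → ℂ⟦X⟧ :=
  ![C (a 0) * cubeRootSeries (a 1 ^ 3), C (a 1) * cubeRootSeries (-a 0 ^ 3)]

/-- The intersection multiplicity with the Fermat cubic, computed along its branch. -/
lemma le_affineIntersectionMultiplicity_affineFermatCubic_iff {a : Fin 2 → ℂ} (h0 : a 0 ≠ 0)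
    (h1 : a 1 ≠ 0) (ha : a 0 ^ 3 + a 1 ^ 3 + 1 = 0) (g : MvPolynomial (Fin 2) ℂ) (n : ℕ) :
    (n : ℕ∞) ≤ affineIntersectionMultiplicity affineFermatCubic g a ↔
      X ^ n ∣ MvPolynomial.aeval (fermatBranch a) g := by
  have hw : ∀ i, constantCoeff (fermatBranch a i) = a i := by
    intro i
    fin_cases i <;> simp [fermatBranch]
  have hf : MvPolynomial.aeval (fermatBranch a) affineFermatCubic = 0 := by
    have hC := congrArg (C (R := ℂ)) ha
    simp only [affineFermatCubic, fermatBranch, map_add, map_pow, MvPolynomial.aeval_X, map_one,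
      Matrix.cons_val_zero, Matrix.cons_val_one, mul_pow, cubeRootSeries_pow_three, map_zero,
      map_neg] at hC ⊢
    linear_combination hC
  obtain ⟨δ, hδ, hδ'⟩ := exists_cubeRootSeries_eq (a 1 ^ 3)
  have hτ : MvPolynomial.aeval (fermatBranch a)
      (MvPolynomial.X 0 - MvPolynomial.C (a 0)) = X * (C (a 0) * δ) := by
    simp only [fermatBranch, map_sub, MvPolynomial.aeval_X, Matrix.cons_val_zero, hδ',
      MvPolynomial.aeval_C, PowerSeries.algebraMap_apply, Algebra.algebraMap_self, RingHom.id_apply]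
    ring
  have hδ0 : constantCoeff (C (a 0) * δ) ≠ 0 := by simp [hδ, h0, h1]
  constructor
  · refine X_pow_dvd_of_le_affineIntersectionMultiplicity (fermatBranch a) hw
      -- From `x³ - a₀³ = (x - a₀)(x² + a₀x + a₀²)` and likewise in `y`; the value of `s` at `a` is
      -- `3 a₁²`.
      (r := MvPolynomial.X 0 ^ 2 + MvPolynomial.X 0 * MvPolynomial.C (a 0) +
        MvPolynomial.C (a 0) ^ 2)
      (s := MvPolynomial.X 1 ^ 2 + MvPolynomial.X 1 * MvPolynomial.C (a 1) +
        MvPolynomial.C (a 1) ^ 2) ?_ ?_ hδ0 hτ hf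
    · have hC := congrArg (MvPolynomial.C (R := ℂ) (σ := Fin 2)) ha
      simp only [map_add, map_pow, map_one, map_zero] at hC
      rw [affineFermatCubic]
      linear_combination hC
    · simp only [map_add, map_pow, MvPolynomial.eval_X, map_mul, MvPolynomial.eval_C]
      have : a 1 ^ 2 + a 1 * a 1 + a 1 ^ 2 = 3 * a 1 ^ 2 := by ring
      rw [this]
      exact mul_ne_zero three_ne_zero (pow_ne_zero 2 h1)
  · exact fun h => le_affineIntersectionMultiplicity (fermatBranch a) hw _ hδ0 hτ
      (hf ▸ dvd_zero _) h

/-- The polynomial of degree at most two with coefficients `k`. -/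
noncomputable def affineConic (k : Fin 6 → ℂ) : MvPolynomial (Fin 2) ℂ :=
  MvPolynomial.C (k 0) + MvPolynomial.C (k 1) * MvPolynomial.X 0 +
    MvPolynomial.C (k 2) * MvPolynomial.X 1 + MvPolynomial.C (k 3) * MvPolynomial.X 0 ^ 2 +
    MvPolynomial.C (k 4) * (MvPolynomial.X 0 * MvPolynomial.X 1) +
    MvPolynomial.C (k 5) * MvPolynomial.X 1 ^ 2

/-- Absorbing the powers of `a₀` and `a₁` into the coefficients leaves a linear system that depends
only on `P = a₁³` and `Q = -a₀³`. -/
lemma six_le_affineIntersectionMultiplicity_affineConic_iff {a : Fin 2 → ℂ} (h0 : a 0 ≠ 0)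
    (h1 : a 1 ≠ 0) (ha : a 0 ^ 3 + a 1 ^ 3 + 1 = 0) (k : Fin 6 → ℂ) :
    6 ≤ affineIntersectionMultiplicity affineFermatCubic (affineConic k) a ↔
      X ^ 6 ∣ C (k 0) + C (k 1 * a 0) * cubeRootSeries (a 1 ^ 3) +
        C (k 2 * a 1) * cubeRootSeries (-a 0 ^ 3) +
        C (k 3 * a 0 ^ 2) * cubeRootSeries (a 1 ^ 3) ^ 2 +
        C (k 4 * (a 0 * a 1)) * (cubeRootSeries (a 1 ^ 3) * cubeRootSeries (-a 0 ^ 3)) +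
        C (k 5 * a 1 ^ 2) * cubeRootSeries (-a 0 ^ 3) ^ 2 := by
  have := le_affineIntersectionMultiplicity_affineFermatCubic_iff h0 h1 ha (affineConic k) 6
  rw [Nat.cast_ofNat] at this
  rw [this]
  refine iff_of_eq (congrArg _ ?_)
  simp only [affineConic, fermatBranch, map_add, map_mul, map_pow, MvPolynomial.aeval_X,
    MvPolynomial.aeval_C, Matrix.cons_val_zero, Matrix.cons_val_one, PowerSeries.algebraMap_apply,
    Algebra.algebraMap_self, RingHom.id_apply]
  ring

/-- A conic hyperosculates the affine Fermat cubic at `a` only if two of `a₀³`, `a₁³`, `1` agree. -/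
lemma eq_zero_of_six_le_affineIntersectionMultiplicity {a : Fin 2 → ℂ} (h0 : a 0 ≠ 0)
    (h1 : a 1 ≠ 0) (ha : a 0 ^ 3 + a 1 ^ 3 + 1 = 0)
    (hne : (a 0 ^ 3 - a 1 ^ 3) * (a 0 ^ 3 - 1) * (a 1 ^ 3 - 1) ≠ 0) (k : Fin 6 → ℂ)
    (h : 6 ≤ affineIntersectionMultiplicity affineFermatCubic (affineConic k) a) : k = 0 := by
  rw [six_le_affineIntersectionMultiplicity_affineConic_iff h0 h1 ha,
    X_pow_six_dvd_conic_iff] at h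
  have hP0 : a 1 ^ 3 ≠ 0 := pow_ne_zero _ h1
  have hQ0 : -a 0 ^ 3 ≠ 0 := neg_ne_zero.mpr (pow_ne_zero _ h0)
  have hPQ : a 1 ^ 3 - -a 0 ^ 3 ≠ 0 := by
    rw [show a 1 ^ 3 - -a 0 ^ 3 = -1 by linear_combination ha]
    norm_num
  have hD : (a 1 ^ 3 + -a 0 ^ 3) * (a 1 ^ 3 - 2 * -a 0 ^ 3) * (2 * a 1 ^ 3 - -a 0 ^ 3) ≠ 0 := by
    have e : (a 1 ^ 3 + -a 0 ^ 3) * (a 1 ^ 3 - 2 * -a 0 ^ 3) * (2 * a 1 ^ 3 - -a 0 ^ 3) =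
        -((a 0 ^ 3 - a 1 ^ 3) * (a 0 ^ 3 - 1) * (a 1 ^ 3 - 1)) := by
      have e1 : a 1 ^ 3 = - a 0 ^ 3 - 1 := by linear_combination ha
      rw [e1]
      ring
    rwa [e, neg_ne_zero]
  generalize a 1 ^ 3 = P at *
  generalize -a 0 ^ 3 = Q at *
  obtain ⟨E0, E1, E2, E3, E4, E5⟩ := h
  -- Only `E0` involves `k 0`, so `E1`–`E5` form a 5 × 5 system. The combinations below are the rows
  -- of its inverse with denominators cleared; these involve only `P`, `Q`, `P - Q` and the three
  -- factors of `hD`.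
  have hk : k 1 * a 0 = 0 ∧ k 2 * a 1 = 0 ∧ k 3 * a 0 ^ 2 = 0 ∧ k 4 * (a 0 * a 1) = 0 ∧
      k 5 * a 1 ^ 2 = 0 := by
    generalize k 1 * a 0 = k₁ at *
    generalize k 2 * a 1 = k₂ at *
    generalize k 3 * a 0 ^ 2 = k₃ at *
    generalize k 4 * (a 0 * a 1) = k₄ at *
    generalize k 5 * a 1 ^ 2 = k₅ at *
    have hc : (Q - P) * ((P + Q) * (P - 2 * Q) * (2 * P - Q)) ≠ 0 :=
      mul_ne_zero (neg_sub P Q ▸ neg_ne_zero.mpr hPQ) hD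
    refine ⟨?_, ?_, ?_, ?_, ?_⟩
    · refine (mul_eq_zero.mp (?_ : (P ^ 2 * Q *
        ((Q - P) * ((P + Q) * (P - 2 * Q) * (2 * P - Q)))) * k₁ = 0)).resolve_left
        (mul_ne_zero (by positivity) hc)
      linear_combination (-2 * P * Q ^ 5 - 3 * P ^ 2 * Q ^ 4 + 12 * P ^ 3 * Q ^ 3 - 14 * P ^ 4 * Q ^ 2) * E1 +
        (-4 * Q ^ 5 - 38 * P * Q ^ 4 + 32 * P ^ 2 * Q ^ 3 - 18 * P ^ 3 * Q ^ 2 - 84 * P ^ 4 * Q) * E2 +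
        (-8 * Q ^ 4 - 12 * P * Q ^ 3 + 13 * P ^ 2 * Q ^ 2 - 42 * P ^ 3 * Q - 14 * P ^ 4) * E3 +
        (-8 * Q ^ 3 + 2 * P * Q ^ 2 - 8 * P ^ 2 * Q - 18 * P ^ 3) * E4 +
        (-2 * Q ^ 2 + 2 * P * Q - 5 * P ^ 2) * E5
    · refine (mul_eq_zero.mp (?_ : (P * Q ^ 2 *
        ((Q - P) * ((P + Q) * (P - 2 * Q) * (2 * P - Q)))) * k₂ = 0)).resolve_left
        (mul_ne_zero (by positivity) hc)
      linear_combination (14 * P ^ 2 * Q ^ 4 - 12 * P ^ 3 * Q ^ 3 + 3 * P ^ 4 * Q ^ 2 + 2 * P ^ 5 * Q) * E1 +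
        (84 * P * Q ^ 4 + 18 * P ^ 2 * Q ^ 3 - 32 * P ^ 3 * Q ^ 2 + 38 * P ^ 4 * Q + 4 * P ^ 5) * E2 +
        (14 * Q ^ 4 + 42 * P * Q ^ 3 - 13 * P ^ 2 * Q ^ 2 + 12 * P ^ 3 * Q + 8 * P ^ 4) * E3 +
        (18 * Q ^ 3 + 8 * P * Q ^ 2 - 2 * P ^ 2 * Q + 8 * P ^ 3) * E4 +
        (5 * Q ^ 2 - 2 * P * Q + 2 * P ^ 2) * E5
    · refine (mul_eq_zero.mp (?_ : (P ^ 2 * (P - Q) *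
        ((Q - P) * ((P + Q) * (P - 2 * Q) * (2 * P - Q)))) * k₃ = 0)).resolve_left
        (mul_ne_zero (by positivity) hc)
      linear_combination (-2 * P * Q ^ 5 + 3 * P ^ 2 * Q ^ 4 - 12 * P ^ 3 * Q ^ 3 + 10 * P ^ 4 * Q ^ 2) * E1 +
        (-2 * Q ^ 5 - 17 * P * Q ^ 4 - 67 * P ^ 2 * Q ^ 3 + 8 * P ^ 3 * Q ^ 2 + 60 * P ^ 4 * Q) * E2 +
        (-4 * Q ^ 4 - 19 * P * Q ^ 3 - 34 * P ^ 2 * Q ^ 2 + 36 * P ^ 3 * Q + 10 * P ^ 4) * E3 +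
        (-4 * Q ^ 3 - 19 * P * Q ^ 2 + P ^ 2 * Q + 16 * P ^ 3) * E4 +
        (-1 * Q ^ 2 - 5 * P * Q + 5 * P ^ 2) * E5
    · refine (mul_eq_zero.mp (?_ : (P * Q * (P - Q) *
        ((Q - P) * ((P + Q) * (P - 2 * Q) * (2 * P - Q)))) * k₄ = 0)).resolve_left
        (mul_ne_zero (by positivity) hc)
      linear_combination (14 * P ^ 2 * Q ^ 4 - 26 * P ^ 3 * Q ^ 3 + 14 * P ^ 4 * Q ^ 2) * E1 +
        (84 * P * Q ^ 4 - 66 * P ^ 2 * Q ^ 3 - 66 * P ^ 3 * Q ^ 2 + 84 * P ^ 4 * Q) * E2 +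
        (14 * Q ^ 4 + 28 * P * Q ^ 3 - 62 * P ^ 2 * Q ^ 2 + 28 * P ^ 3 * Q + 14 * P ^ 4) * E3 +
        (18 * Q ^ 3 - 12 * P * Q ^ 2 - 12 * P ^ 2 * Q + 18 * P ^ 3) * E4 +
        (5 * Q ^ 2 - 8 * P * Q + 5 * P ^ 2) * E5
    · refine (mul_eq_zero.mp (?_ : (Q ^ 2 * (P - Q) *
        ((Q - P) * ((P + Q) * (P - 2 * Q) * (2 * P - Q)))) * k₅ = 0)).resolve_left
        (mul_ne_zero (by positivity) hc)
      linear_combination (10 * P ^ 2 * Q ^ 4 - 12 * P ^ 3 * Q ^ 3 + 3 * P ^ 4 * Q ^ 2 - 2 * P ^ 5 * Q) * E1 +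
        (60 * P * Q ^ 4 + 8 * P ^ 2 * Q ^ 3 - 67 * P ^ 3 * Q ^ 2 - 17 * P ^ 4 * Q - 2 * P ^ 5) * E2 +
        (10 * Q ^ 4 + 36 * P * Q ^ 3 - 34 * P ^ 2 * Q ^ 2 - 19 * P ^ 3 * Q - 4 * P ^ 4) * E3 +
        (16 * Q ^ 3 + P * Q ^ 2 - 19 * P ^ 2 * Q - 4 * P ^ 3) * E4 +
        (5 * Q ^ 2 - 5 * P * Q - P ^ 2) * E5
  obtain ⟨z1, z2, z3, z4, z5⟩ := hk
  rw [z1, z2, z3, z4, z5] at E0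
  simp only [mul_eq_zero, h0, h1, or_false, pow_eq_zero_iff, ne_eq, OfNat.ofNat_ne_zero,
    not_false_eq_true] at z1 z2 z3 z4 z5
  funext i
  fin_cases i <;> simp_all

/-- If two of `a₀³`, `a₁³`, `1` agree, some conic hyperosculates the affine Fermat cubic at `a`. -/
lemma exists_six_le_affineIntersectionMultiplicity {a : Fin 2 → ℂ} (h0 : a 0 ≠ 0)
    (h1 : a 1 ≠ 0) (ha : a 0 ^ 3 + a 1 ^ 3 + 1 = 0)
    (heq : (a 0 ^ 3 - a 1 ^ 3) * (a 0 ^ 3 - 1) * (a 1 ^ 3 - 1) = 0) :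
    ∃ k : Fin 6 → ℂ, k ≠ 0 ∧
      6 ≤ affineIntersectionMultiplicity affineFermatCubic (affineConic k) a := by
  have hP0 : a 1 ^ 3 ≠ 0 := pow_ne_zero _ h1
  have hQ0 : -a 0 ^ 3 ≠ 0 := neg_ne_zero.mpr (pow_ne_zero _ h0)
  have hD : (a 1 ^ 3 + -a 0 ^ 3) * (a 1 ^ 3 - 2 * -a 0 ^ 3) * (2 * a 1 ^ 3 - -a 0 ^ 3) = 0 := by
    have e1 : a 1 ^ 3 = - a 0 ^ 3 - 1 := by linear_combination ha
    rw [e1] at heq ⊢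
    linear_combination -heq
  obtain ⟨P, hP⟩ : ∃ P, P = a 1 ^ 3 := ⟨_, rfl⟩
  obtain ⟨Q, hQ⟩ : ∃ Q, Q = -a 0 ^ 3 := ⟨_, rfl⟩
  rw [← hP, ← hQ] at hD
  rw [← hP] at hP0
  rw [← hQ] at hQ0
  -- Entries 1 to 5 are the multipliers of `E5` in the inverse of the 5 × 5 system, over a common
  -- denominator. They satisfy the equations of orders one to four identically, and the constant
  -- coefficient chosen below settles order zero: this is the conic with contact five.
  let l : Fin 6 → ℂ := ![0, 2 * Q ^ 4 - 4 * P * Q ^ 3 + 7 * P ^ 2 * Q ^ 2 - 5 * P ^ 3 * Q,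
    -5 * P * Q ^ 3 + 7 * P ^ 2 * Q ^ 2 - 4 * P ^ 3 * Q + 2 * P ^ 4,
    -Q ^ 4 - 5 * P * Q ^ 3 + 5 * P ^ 2 * Q ^ 2,
    5 * P * Q ^ 3 - 8 * P ^ 2 * Q ^ 2 + 5 * P ^ 3 * Q,
    5 * P ^ 2 * Q ^ 2 - 5 * P ^ 3 * Q - P ^ 4]
  refine ⟨![-(l 1 + l 2 + l 3 + l 4 + l 5), l 1 / a 0, l 2 / a 1, l 3 / a 0 ^ 2,
    l 4 / (a 0 * a 1), l 5 / a 1 ^ 2], ?_, ?_⟩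
  · intro h
    have h4 := congrFun h 4
    have : l 4 = 0 := by
      simpa [h0, h1] using h4
    -- The quadratic factor equals `18 Q²`, `9 Q²` and `9 P²` on the three lines that make up `hD`.
    have h4' : P * Q * (5 * Q ^ 2 - 8 * P * Q + 5 * P ^ 2) = 0 := by
      rw [← this]
      simp only [l, Matrix.cons_val]
      ring
    have h4'' := (mul_eq_zero.mp h4').resolve_left (mul_ne_zero hP0 hQ0)
    simp only [mul_eq_zero] at hD
    rcases hD with (hD | hD) | hD
    · have : P = -Q := by linear_combination hD
      subst this
      exact pow_ne_zero 2 hQ0 (by linear_combination h4'' / 18)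
    · have : P = 2 * Q := by linear_combination hD
      subst this
      exact pow_ne_zero 2 hQ0 (by linear_combination h4'' / 9)
    · have : Q = 2 * P := by linear_combination -hD
      subst this
      exact pow_ne_zero 2 hP0 (by linear_combination h4'' / 9)
  · rw [six_le_affineIntersectionMultiplicity_affineConic_iff h0 h1 ha, ← hP, ← hQ,
      X_pow_six_dvd_conic_iff]
    simp only [Matrix.cons_val, div_mul_cancel₀ _ h0, div_mul_cancel₀ _ h1,
      div_mul_cancel₀ _ (pow_ne_zero 2 h0), div_mul_cancel₀ _ (pow_ne_zero 2 h1),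
      div_mul_cancel₀ _ (mul_ne_zero h0 h1), l]
    refine ⟨by ring, by ring, by ring, by ring, by ring, ?_⟩
    -- The last equation evaluates to a multiple of the product in `hD`.
    linear_combination -P ^ 2 * Q ^ 2 * (P - Q) ^ 2 * hD

/-- The tangent to the affine Fermat cubic at a point off the axes is an ordinary tangent. -/
lemma not_three_le_affineIntersectionMultiplicity_tangent {a : Fin 2 → ℂ} (h0 : a 0 ≠ 0)
    (h1 : a 1 ≠ 0) (ha : a 0 ^ 3 + a 1 ^ 3 + 1 = 0) {c : ℂ} (hc : c ≠ 0) :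
    ¬ 3 ≤ affineIntersectionMultiplicity affineFermatCubic
      (MvPolynomial.C c * (1 + MvPolynomial.C (a 0 ^ 2) * MvPolynomial.X 0 +
        MvPolynomial.C (a 1 ^ 2) * MvPolynomial.X 1)) a := by
  have := le_affineIntersectionMultiplicity_affineFermatCubic_iff h0 h1 ha
    (MvPolynomial.C c * (1 + MvPolynomial.C (a 0 ^ 2) * MvPolynomial.X 0 +
      MvPolynomial.C (a 1 ^ 2) * MvPolynomial.X 1)) 3
  rw [Nat.cast_ofNat] at this
  rw [this]
  intro h
  have h2 := X_pow_dvd_iff.mp h 2 (by norm_num)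
  simp only [fermatBranch, map_add, map_mul, MvPolynomial.aeval_X, map_one,
    MvPolynomial.aeval_C, Matrix.cons_val_zero, Matrix.cons_val_one, PowerSeries.algebraMap_apply,
    Algebra.algebraMap_self, RingHom.id_apply, coeff_C_mul, coeff_cubeRootSeries,
    choose_third.2.2.1, coeff_one] at h2
  push_cast at h2
  norm_num at h2
  -- The `t²` coefficient is `-c a₀³a₁³(a₀³ + a₁³)/9`, that is `c a₀³a₁³/9`.
  have : a 0 ^ 3 * a 1 ^ 3 = 0 := by
    linear_combination 9 * h2.resolve_left hc + a 0 ^ 3 * a 1 ^ 3 * ha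
  simp [h0, h1] at this

/-- The points of the affine Fermat cubic on the axes are inflection points. -/
lemma three_le_affineIntersectionMultiplicity_tangent {a : Fin 2 → ℂ} (h : a 0 * a 1 = 0)
    (ha : a 0 ^ 3 + a 1 ^ 3 + 1 = 0) (c : ℂ) :
    3 ≤ affineIntersectionMultiplicity affineFermatCubic
      (MvPolynomial.C c * (1 + MvPolynomial.C (a 0 ^ 2) * MvPolynomial.X 0 +
        MvPolynomial.C (a 1 ^ 2) * MvPolynomial.X 1)) a := by
  have hC := congrArg (C (R := ℂ)) ha
  simp only [map_add, map_pow, map_one, map_zero] at hC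
  rcases mul_eq_zero.mp h with h | h
  · rw [h, map_zero] at hC
    -- The arc is the tangent line itself, here `y = a₁`: the tangent form vanishes on it and the
    -- cubic restricts to `t³`.
    have := le_affineIntersectionMultiplicity (f := affineFermatCubic)
      (g := MvPolynomial.C c * (1 + MvPolynomial.C (a 0 ^ 2) * MvPolynomial.X 0 +
        MvPolynomial.C (a 1 ^ 2) * MvPolynomial.X 1)) (a := a) (n := 3) ![X, C (a 1)]
      (by intro i; fin_cases i <;> simp [h]) (MvPolynomial.X 0) (δ := 1) (by simp) (by simp)
      ⟨1, by simp [affineFermatCubic]; linear_combination hC⟩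
      ⟨0, by
        simp [h]
        right
        linear_combination hC⟩
    exact_mod_cast this
  · rw [h, map_zero] at hC
    have := le_affineIntersectionMultiplicity (f := affineFermatCubic)
      (g := MvPolynomial.C c * (1 + MvPolynomial.C (a 0 ^ 2) * MvPolynomial.X 0 +
        MvPolynomial.C (a 1 ^ 2) * MvPolynomial.X 1)) (a := a) (n := 3) ![C (a 0), X]
      (by intro i; fin_cases i <;> simp [h]) (MvPolynomial.X 1) (δ := 1) (by simp) (by simp)
      ⟨1, by simp [affineFermatCubic]; linear_combination hC⟩
      ⟨0, by
        simp [h]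
        right
        linear_combination hC⟩
    exact_mod_cast this

end FermatBranch

/-! ### Passage between ternary forms and affine charts. -/

lemma dehomogenize_X_self (i : Fin 3) : dehomogenize i (MvPolynomial.X i) = 1 := by
  simp [dehomogenize]

lemma dehomogenize_X_succAbove (i : Fin 3) (j : Fin 2) :
    dehomogenize i (MvPolynomial.X (i.succAbove j)) = MvPolynomial.X j := by
  simp [dehomogenize]

lemma dehomogenize_C (i : Fin 3) (c : ℂ) :
    dehomogenize i (MvPolynomial.C c) = MvPolynomial.C c := by
  simp [dehomogenize, MvPolynomial.algebraMap_eq]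

lemma dehomogenize_add (i : Fin 3) (f g : MvPolynomial (Fin 3) ℂ) :
    dehomogenize i (f + g) = dehomogenize i f + dehomogenize i g := map_add _ _ _

lemma dehomogenize_mul (i : Fin 3) (f g : MvPolynomial (Fin 3) ℂ) :
    dehomogenize i (f * g) = dehomogenize i f * dehomogenize i g := map_mul _ _ _

lemma dehomogenize_pow (i : Fin 3) (f : MvPolynomial (Fin 3) ℂ) (n : ℕ) :
    dehomogenize i (f ^ n) = dehomogenize i f ^ n := map_pow _ _ _

lemma fermatCubic_eq_sum : fermatCubic = ∑ j, MvPolynomial.X j ^ 3 := by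
  simp [fermatCubic, Fin.sum_univ_three]

lemma dehomogenize_fermatCubic (i : Fin 3) :
    dehomogenize i fermatCubic = affineFermatCubic := by
  rw [fermatCubic_eq_sum, Fin.sum_univ_succAbove _ i, Fin.sum_univ_two]
  simp only [dehomogenize_add, dehomogenize_pow, dehomogenize_X_self, dehomogenize_X_succAbove,
    affineFermatCubic]
  ring

lemma pderiv_fermatCubic (j : Fin 3) :
    MvPolynomial.pderiv j fermatCubic = 3 * MvPolynomial.X j ^ 2 := by
  rw [fermatCubic_eq_sum, map_sum, Finset.sum_eq_single j]
  · simp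
  · intro k _ hk
    simp [MvPolynomial.pderiv_X_of_ne hk]
  · simp

lemma dehomogenize_tangentLine_fermatCubic (p : P2) :
    dehomogenize (chartIndex p) (tangentLine fermatCubic p) =
      MvPolynomial.C (3 * p.rep (chartIndex p) ^ 2) *
        (1 + MvPolynomial.C (affineCoords p 0 ^ 2) * MvPolynomial.X 0 +
          MvPolynomial.C (affineCoords p 1 ^ 2) * MvPolynomial.X 1) := by
  have hp : p.rep (chartIndex p) ≠ 0 := (exists_rep_ne_zero p).choose_spec
  have h : ∀ j, 3 * p.rep ((chartIndex p).succAbove j) ^ 2 =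
      3 * p.rep (chartIndex p) ^ 2 * affineCoords p j ^ 2 := by
    intro j
    rw [affineCoords]
    field_simp
  rw [tangentLine, Fin.sum_univ_succAbove _ (chartIndex p), Fin.sum_univ_two]
  simp only [pderiv_fermatCubic, map_mul, map_pow, MvPolynomial.eval_X, map_ofNat]
  have h3 : (3 : MvPolynomial (Fin 3) ℂ) = MvPolynomial.C 3 := rfl
  have h3' : (3 : MvPolynomial (Fin 2) ℂ) = MvPolynomial.C 3 := rfl
  have h0 := congrArg (MvPolynomial.C (σ := Fin 2)) (h 0)
  have h1 := congrArg (MvPolynomial.C (σ := Fin 2)) (h 1)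
  simp only [map_mul, map_pow] at h0 h1
  simp only [h3, h3', dehomogenize_add, dehomogenize_mul, dehomogenize_pow, dehomogenize_C,
    dehomogenize_X_self, dehomogenize_X_succAbove]
  linear_combination MvPolynomial.X 0 * h0 + MvPolynomial.X 1 * h1

lemma eval_fermatCubic (v : Fin 3 → ℂ) : MvPolynomial.eval v fermatCubic = ∑ j, v j ^ 3 := by
  simp [fermatCubic_eq_sum]

/-- The quadratic form with coefficients `k`, in coordinates adapted to the `i`-th chart. -/
noncomputable def quadraticForm (i : Fin 3) (k : Fin 6 → ℂ) : MvPolynomial (Fin 3) ℂ :=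
  MvPolynomial.C (k 0) * MvPolynomial.X i ^ 2 +
    MvPolynomial.C (k 1) * (MvPolynomial.X i * MvPolynomial.X (i.succAbove 0)) +
    MvPolynomial.C (k 2) * (MvPolynomial.X i * MvPolynomial.X (i.succAbove 1)) +
    MvPolynomial.C (k 3) * MvPolynomial.X (i.succAbove 0) ^ 2 +
    MvPolynomial.C (k 4) * (MvPolynomial.X (i.succAbove 0) * MvPolynomial.X (i.succAbove 1)) +
    MvPolynomial.C (k 5) * MvPolynomial.X (i.succAbove 1) ^ 2

lemma dehomogenize_quadraticForm (i : Fin 3) (k : Fin 6 → ℂ) :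
    dehomogenize i (quadraticForm i k) = affineConic k := by
  simp [quadraticForm, affineConic, dehomogenize, MvPolynomial.algebraMap_eq]

/-- Its values at `(0,0)`, `(±1,0)`, `(0,±1)`, `(1,1)` already determine the six coefficients. -/
lemma affineConic_eq_zero {k : Fin 6 → ℂ} (h : affineConic k = 0) : k = 0 := by
  have e : ∀ x y : ℂ, k 0 + k 1 * x + k 2 * y + k 3 * x ^ 2 + k 4 * (x * y) + k 5 * y ^ 2 = 0 := by
    intro x y
    simpa [affineConic] using congrArg (MvPolynomial.eval ![x, y]) h
  have e1 := e 0 0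
  have e2 := e 1 0
  have e3 := e (-1) 0
  have e4 := e 0 1
  have e5 := e 0 (-1)
  have e6 := e 1 1
  funext i
  fin_cases i <;> simp only [Fin.reduceFinMk, Fin.zero_eta, Fin.mk_one, Pi.zero_apply]
  · linear_combination e1
  · linear_combination (e2 - e3) / 2
  · linear_combination (e4 - e5) / 2
  · linear_combination (e2 + e3) / 2 - e1
  · linear_combination e6 - e2 - e4 + e1
  · linear_combination (e4 + e5) / 2 - e1

lemma quadraticForm_isHomogeneous (i : Fin 3) (k : Fin 6 → ℂ) :
    (quadraticForm i k).IsHomogeneous 2 := by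
  have h1 := fun j : Fin 3 => MvPolynomial.isHomogeneous_X ℂ j
  have hm : ∀ (c : ℂ) (j l : Fin 3), (MvPolynomial.C c * (MvPolynomial.X j * MvPolynomial.X l) :
      MvPolynomial (Fin 3) ℂ).IsHomogeneous 2 := fun c j l => ((h1 j).mul (h1 l)).C_mul c
  simp only [quadraticForm, pow_two]
  exact (((((hm _ _ _).add (hm _ _ _)).add (hm _ _ _)).add (hm _ _ _)).add (hm _ _ _)).add
    (hm _ _ _)

lemma quadraticForm_add (i : Fin 3) (k l : Fin 6 → ℂ) :
    quadraticForm i (k + l) = quadraticForm i k + quadraticForm i l := by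
  simp only [quadraticForm, Pi.add_apply, map_add]
  ring

/-- It suffices to treat monomials, and there are six exponent patterns of degree two. -/
lemma exists_eq_quadraticForm (i : Fin 3) {q : MvPolynomial (Fin 3) ℂ} (hq : q.IsHomogeneous 2) :
    ∃ k, q = quadraticForm i k := by
  rw [q.as_sum]
  refine Finset.sum_induction _ (fun r => ∃ k, r = quadraticForm i k) ?_ ⟨0, by
    simp [quadraticForm]⟩ ?_
  · rintro _ _ ⟨k, rfl⟩ ⟨l, rfl⟩
    exact ⟨k + l, (quadraticForm_add i k l).symm⟩
  · intro m hm
    have hdeg : m i + (m (i.succAbove 0) + m (i.succAbove 1)) = 2 := by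
      have := hq (MvPolynomial.mem_support_iff.mp hm)
      change Finsupp.weight (fun _ => 1) m = 2 at this
      rw [← Finsupp.degree_eq_weight_one, Finsupp.degree_eq_sum,
        Fin.sum_univ_succAbove _ i, Fin.sum_univ_two] at this
      exact this
    rw [MvPolynomial.monomial_eq, Finsupp.prod_fintype _ _ (by simp), Fin.prod_univ_succAbove _ i,
      Fin.prod_univ_two]
    generalize MvPolynomial.coeff m q = c
    have hcases : (m i = 2 ∧ m (i.succAbove 0) = 0 ∧ m (i.succAbove 1) = 0) ∨
        (m i = 1 ∧ m (i.succAbove 0) = 1 ∧ m (i.succAbove 1) = 0) ∨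
        (m i = 1 ∧ m (i.succAbove 0) = 0 ∧ m (i.succAbove 1) = 1) ∨
        (m i = 0 ∧ m (i.succAbove 0) = 2 ∧ m (i.succAbove 1) = 0) ∨
        (m i = 0 ∧ m (i.succAbove 0) = 1 ∧ m (i.succAbove 1) = 1) ∨
        (m i = 0 ∧ m (i.succAbove 0) = 0 ∧ m (i.succAbove 1) = 2) := by omega
    rcases hcases with ⟨h, h', h''⟩ | ⟨h, h', h''⟩ | ⟨h, h', h''⟩ | ⟨h, h', h''⟩ |
      ⟨h, h', h''⟩ | ⟨h, h', h''⟩ <;> rw [h, h', h'']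
    · exact ⟨![c, 0, 0, 0, 0, 0], by simp [quadraticForm]⟩
    · exact ⟨![0, c, 0, 0, 0, 0], by simp [quadraticForm]⟩
    · exact ⟨![0, 0, c, 0, 0, 0], by simp [quadraticForm]⟩
    · exact ⟨![0, 0, 0, c, 0, 0], by simp [quadraticForm]⟩
    · exact ⟨![0, 0, 0, 0, c, 0], by simp [quadraticForm]⟩
    · exact ⟨![0, 0, 0, 0, 0, c], by simp [quadraticForm]⟩

/-! ### Sextactic points in homogeneous coordinates. -/

/-- The condition on homogeneous coordinates that characterizes the sextactic points of the
Fermat cubic. -/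
def IsSextacticVector (v : Fin 3 → ℂ) : Prop :=
  ∑ j, v j ^ 3 = 0 ∧ (∀ j, v j ≠ 0) ∧ ∃ j k, j ≠ k ∧ v j ^ 3 = v k ^ 3

lemma isSextacticVector_smul_iff {c : ℂ} (hc : c ≠ 0) (v : Fin 3 → ℂ) :
    IsSextacticVector (c • v) ↔ IsSextacticVector v := by
  simp [IsSextacticVector, mul_pow, ← Finset.mul_sum, hc]

lemma isSextacticVector_iff_of_chart {v : Fin 3 → ℂ} {i : Fin 3} (hi : v i ≠ 0) {a : Fin 2 → ℂ}
    (ha : ∀ j, a j = v (i.succAbove j) / v i) :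
    IsSextacticVector v ↔ a 0 ^ 3 + a 1 ^ 3 + 1 = 0 ∧ a 0 * a 1 ≠ 0 ∧
      (a 0 ^ 3 - a 1 ^ 3) * (a 0 ^ 3 - 1) * (a 1 ^ 3 - 1) = 0 := by
  -- The condition is invariant under scaling, so the `i`-th coordinate may be taken to be `1`.
  have hv : v = v i • (i.insertNth 1 a : Fin 3 → ℂ) := by
    funext l
    obtain rfl | ⟨j, rfl⟩ := Fin.eq_self_or_eq_succAbove i l
    · simp
    · simp [ha, mul_div_cancel₀ _ hi]
  rw [hv, isSextacticVector_smul_iff hi, IsSextacticVector, Fin.sum_univ_succAbove _ i,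
    Fin.forall_iff_succAbove i, Fin.exists_iff_succAbove i]
  simp only [Fin.exists_iff_succAbove i, Fin.sum_univ_two, Fin.forall_fin_two, Fin.exists_fin_two,
    Fin.insertNth_apply_same, Fin.insertNth_apply_succAbove,
    mul_ne_zero_iff, mul_eq_zero, sub_eq_zero]
  simp only [ne_eq, not_true_eq_false, false_and, false_or, Fin.succAbove_ne, not_false_eq_true,
    true_and, one_pow, one_ne_zero, Fin.ne_succAbove, Fin.succAbove_right_inj, zero_ne_one, or_false]
  rw [add_comm 1, eq_comm (a := (1 : ℂ)), eq_comm (a := (1 : ℂ)),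
    eq_comm (a := a 1 ^ 3) (b := a 0 ^ 3)]
  tauto

theorem isSextacticPoint_fermatCubic_iff_rep (p : P2) :
    IsSextacticPoint fermatCubic p ↔ IsSextacticVector p.rep := by
  have hp : p.rep (chartIndex p) ≠ 0 := (exists_rep_ne_zero p).choose_spec
  rw [isSextacticVector_iff_of_chart hp (a := affineCoords p) fun j => rfl]
  have hcurve : ∑ j, p.rep j ^ 3 = 0 ↔ affineCoords p 0 ^ 3 + affineCoords p 1 ^ 3 + 1 = 0 := by
    have : ∑ j, p.rep j ^ 3 = p.rep (chartIndex p) ^ 3 *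
        (affineCoords p 0 ^ 3 + affineCoords p 1 ^ 3 + 1) := by
      rw [Fin.sum_univ_succAbove _ (chartIndex p), Fin.sum_univ_two, affineCoords, affineCoords]
      field_simp
      ring
    rw [this, mul_eq_zero]
    simp [hp]
  have hsmooth : IsSmoothPoint fermatCubic p ↔
      affineCoords p 0 ^ 3 + affineCoords p 1 ^ 3 + 1 = 0 := by
    rw [IsSmoothPoint, eval_fermatCubic, hcurve, and_iff_left]
    exact ⟨chartIndex p, by simp [pderiv_fermatCubic, hp]⟩
  have hc : 3 * p.rep (chartIndex p) ^ 2 ≠ 0 := mul_ne_zero three_ne_zero (pow_ne_zero 2 hp)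
  rw [IsSextacticPoint, IsInflectionPoint, hsmooth]
  refine and_congr_right fun ha => ?_
  simp only [ha, true_and, intersectionMultiplicity, dehomogenize_fermatCubic,
    dehomogenize_tangentLine_fermatCubic]
  by_cases h01 : affineCoords p 0 * affineCoords p 1 = 0
  · simp only [three_le_affineIntersectionMultiplicity_tangent h01 ha, not_true_eq_false,
      false_and, h01, ne_eq]
  obtain ⟨h0, h1⟩ := mul_ne_zero_iff.mp h01
  simp only [not_three_le_affineIntersectionMultiplicity_tangent h0 h1 ha hc, not_false_eq_true,
    h01, ne_eq, true_and]
  constructor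
  · rintro ⟨q, ⟨hq, hq0⟩, h⟩
    obtain ⟨k, rfl⟩ := exists_eq_quadraticForm (chartIndex p) hq
    rw [dehomogenize_quadraticForm] at h
    by_contra hne
    have := eq_zero_of_six_le_affineIntersectionMultiplicity h0 h1 ha hne k h
    simp [this, quadraticForm] at hq0
  · intro heq
    obtain ⟨k, hk, h⟩ := exists_six_le_affineIntersectionMultiplicity h0 h1 ha heq
    refine ⟨quadraticForm (chartIndex p) k, ⟨quadraticForm_isHomogeneous _ _, fun h0 => hk ?_⟩, ?_⟩
    · apply affineConic_eq_zero
      rw [← dehomogenize_quadraticForm (chartIndex p), h0]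
      exact map_zero _
    · rwa [dehomogenize_quadraticForm]

theorem isSextacticPoint_fermatCubic_mk_iff {v : Fin 3 → ℂ} (hv : v ≠ 0) :
    IsSextacticPoint fermatCubic (Projectivization.mk ℂ v hv) ↔ IsSextacticVector v := by
  rw [isSextacticPoint_fermatCubic_iff_rep]
  obtain ⟨c, hc⟩ := Projectivization.exists_smul_eq_mk_rep ℂ v hv
  rw [← hc]
  exact isSextacticVector_smul_iff c.ne_zero v

/-! ### The groups `G` and `G'` as monomial matrices modulo scalars. -/

/-- The homomorphism from the torus of diagonal matrices to `PGL₃`. -/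
noncomputable def diagonalAut : (Fin 3 → ℂˣ) →* PGL3 :=
  Matrix.ProjGenLinGroup.mk.comp
    { toFun := diagonalGL
      map_one' := by
        ext i j
        simp [diagonalGL]
      map_mul' := fun d e => by
        apply Units.ext
        simp [diagonalGL, Matrix.diagonal_mul_diagonal] }

/-- The permutation matrix of `σ` as an invertible matrix. -/
noncomputable def permGL (σ : Equiv.Perm (Fin 3)) : GL (Fin 3) ℂ :=
  (Matrix.permMatrixHom (n := Fin 3) (R := ℂ)).toHomUnits σ

lemma diagonalAut_apply (d : Fin 3 → ℂˣ) :
    diagonalAut d = Matrix.ProjGenLinGroup.mk (diagonalGL d) := rfl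

/-- Permutations of the coordinates as a homomorphism to `PGL₃`. -/
noncomputable def permAutHom : Equiv.Perm (Fin 3) →* PGL3 :=
  Matrix.ProjGenLinGroup.mk.comp (Matrix.permMatrixHom (n := Fin 3) (R := ℂ)).toHomUnits

lemma permAutHom_apply (σ : Equiv.Perm (Fin 3)) : permAutHom σ = permAut σ := rfl

lemma mk_eq_mk_of_mulVec {A B : GL (Fin 3) ℂ} (u : ℂˣ)
    (h : ∀ v : Fin 3 → ℂ, A.1.mulVec v = (u : ℂ) • B.1.mulVec v) :
    Matrix.ProjGenLinGroup.mk A = Matrix.ProjGenLinGroup.mk B := by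
  rw [eq_comm, Matrix.ProjGenLinGroup.mk_eq_mk_iff]
  refine ⟨u, Units.ext (Matrix.toLin'.injective (LinearMap.ext fun v => ?_))⟩
  simp [h]

lemma exists_mulVec_eq {A B : GL (Fin 3) ℂ}
    (h : Matrix.ProjGenLinGroup.mk A = Matrix.ProjGenLinGroup.mk B) :
    ∃ u : ℂˣ, ∀ v : Fin 3 → ℂ, A.1.mulVec v = (u : ℂ) • B.1.mulVec v := by
  obtain ⟨u, rfl⟩ := Matrix.ProjGenLinGroup.mk_eq_mk_iff.mp h.symm
  refine ⟨u, fun v => ?_⟩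
  simp [← Matrix.mulVec_mulVec, Matrix.mulVec_smul]

lemma diagonalGL_mulVec (d : Fin 3 → ℂˣ) (v : Fin 3 → ℂ) :
    (diagonalGL d).1.mulVec v = fun i => (d i : ℂ) * v i := by
  ext i
  simp [diagonalGL, Matrix.mulVec_diagonal]

lemma permGL_mulVec (σ : Equiv.Perm (Fin 3)) (v : Fin 3 → ℂ) :
    (permGL σ).1.mulVec v = v ∘ ⇑σ⁻¹ := by
  simp [permGL, Matrix.permMatrix_mulVec]

lemma diagonalAut_const (c : ℂˣ) : diagonalAut (fun _ => c) = 1 := by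
  rw [diagonalAut_apply, ← Matrix.ProjGenLinGroup.mk_one]
  refine mk_eq_mk_of_mulVec c fun v => ?_
  rw [diagonalGL_mulVec]
  ext i
  simp

/-- A diagonal matrix and a permutation matrix are projectively equal only if both are trivial. -/
lemma eq_of_diagonalAut_eq_permAutHom {d : Fin 3 → ℂˣ} {σ : Equiv.Perm (Fin 3)}
    (h : diagonalAut d = permAutHom σ) : σ = 1 ∧ ∀ i j, d i = d j := by
  obtain ⟨u, hu⟩ := exists_mulVec_eq (A := diagonalGL d) (B := permGL σ) h
  simp only [diagonalGL_mulVec, permGL_mulVec] at hu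
  have h1 : σ = 1 := by
    ext1 j
    by_contra hj
    have hj' : σ j ≠ j := hj
    -- At coordinate `σ j` the diagonal matrix gives `0` on this basis vector, while the scaled
    -- permutation matrix gives `u`.
    have := congrFun (hu (Pi.single j 1)) (σ j)
    simp [hj'] at this
    exact u.ne_zero this.symm
  refine ⟨h1, fun i j => Units.ext ?_⟩
  have := congrFun (hu 1)
  simp only [Pi.one_apply, mul_one, Pi.smul_apply, Function.comp_apply] at this
  rw [this i, this j]

lemma eq_of_diagonalAut_eq_one {d : Fin 3 → ℂˣ} (h : diagonalAut d = 1) (i j : Fin 3) :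
    d i = d j :=
  (eq_of_diagonalAut_eq_permAutHom (σ := 1) (h.trans (map_one _).symm)).2 i j

lemma permAutHom_injective : Function.Injective permAutHom :=
  (injective_iff_map_eq_one _).mpr fun _ h =>
    (eq_of_diagonalAut_eq_permAutHom (d := 1) ((map_one _).trans h.symm)).1

lemma permAutHom_mul_diagonalAut (σ : Equiv.Perm (Fin 3)) (d : Fin 3 → ℂˣ) :
    permAutHom σ * diagonalAut d * (permAutHom σ)⁻¹ = diagonalAut (d ∘ ⇑σ⁻¹) := by
  rw [mul_inv_eq_iff_eq_mul]
  change Matrix.ProjGenLinGroup.mk (permGL σ * diagonalGL d) =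
    Matrix.ProjGenLinGroup.mk (diagonalGL (d ∘ ⇑σ⁻¹) * permGL σ)
  refine mk_eq_mk_of_mulVec 1 fun v => ?_
  rw [Units.val_mul, Units.val_mul, ← Matrix.mulVec_mulVec, ← Matrix.mulVec_mulVec,
    permGL_mulVec, permGL_mulVec, diagonalGL_mulVec, diagonalGL_mulVec]
  ext i
  simp

/-- The group `G` consists of the diagonal automorphisms whose entries are cube roots of unity. -/
lemma groupG_eq {ω : ℂˣ} (hω : IsPrimitiveRoot ω 3) :
    groupG ω = (powMonoidHom 3 : (Fin 3 → ℂˣ) →* _).ker.map diagonalAut := by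
  have h3 := hω.pow_eq_one
  apply le_antisymm
  · rw [groupG, Subgroup.closure_le]
    rintro x (rfl | rfl)
    · refine ⟨![ω, 1, 1], ?_, rfl⟩
      rw [SetLike.mem_coe, MonoidHom.mem_ker]
      ext i
      fin_cases i <;> simp [h3]
    · refine ⟨![1, ω, 1], ?_, rfl⟩
      rw [SetLike.mem_coe, MonoidHom.mem_ker]
      ext i
      fin_cases i <;> simp [h3]
  · rintro _ ⟨d, hd, rfl⟩
    have hd' : ∀ i, ∃ n < 3, ω ^ n = d i := fun i =>
      hω.eq_pow_of_mem_rootsOfUnity ((mem_rootsOfUnity _ _).mpr (congrFun hd i))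
    choose n _ hn using hd'
    -- Dividing by the scalar `ω ^ n 2` makes the last entry `1`; the exponent `-n 2` is written `2
    -- * n 2`, as `ω` has order three.
    have : diagonalAut d = g₁ ω ^ (n 0 + 2 * n 2) * g₂ ω ^ (n 1 + 2 * n 2) := by
      change _ = diagonalAut _ ^ _ * diagonalAut _ ^ _
      rw [← map_pow, ← map_pow, ← map_mul, ← mul_one (diagonalAut (_ * _)),
        ← diagonalAut_const (ω ^ n 2), ← map_mul]
      congr 1
      have hp : ∀ m, ω ^ (m + 2 * n 2) * ω ^ n 2 = ω ^ m := by
        intro m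
        rw [← pow_add, add_assoc, show 2 * n 2 + n 2 = 3 * n 2 by ring, pow_add, pow_mul, h3,
          one_pow, mul_one]
      funext i
      fin_cases i <;> simp [← hn, hp]
    rw [this]
    exact mul_mem (pow_mem (Subgroup.subset_closure (by simp)) _)
      (pow_mem (Subgroup.subset_closure (by simp)) _)

lemma diagonalAut_mem_groupG {ω : ℂˣ} (hω : IsPrimitiveRoot ω 3) {d : Fin 3 → ℂˣ}
    (hd : ∀ i, d i ^ 3 = 1) : diagonalAut d ∈ groupG ω := by
  rw [groupG_eq hω]
  exact ⟨d, funext hd, rfl⟩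

lemma exists_of_mem_groupG {ω : ℂˣ} (hω : IsPrimitiveRoot ω 3) {x : PGL3} (hx : x ∈ groupG ω) :
    ∃ d : Fin 3 → ℂˣ, (∀ i, d i ^ 3 = 1) ∧ x = diagonalAut d := by
  rw [groupG_eq hω] at hx
  obtain ⟨d, hd, rfl⟩ := hx
  exact ⟨d, congrFun hd, rfl⟩

/-- The parametrization of `G` by `ℤ/3 × ℤ/3`. -/
lemma exists_mulEquiv_groupG {ω : ℂˣ} (hω : IsPrimitiveRoot ω 3) :
    Nonempty (groupG ω ≃* Multiplicative (ZMod 3) × Multiplicative (ZMod 3)) := by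
  let e : Multiplicative (ZMod 3) →* ℂˣ :=
    (Subgroup.zpowers ω).subtype.comp hω.zmodEquivZPowers.toMultiplicativeLeft.toMonoidHom
  have he : Function.Injective e :=
    Subtype.val_injective.comp hω.zmodEquivZPowers.toMultiplicativeLeft.injective
  have he1 : e (Multiplicative.ofAdd 1) = ω := by
    have := hω.zmodEquivZPowers_apply_coe_nat 1
    rw [Nat.cast_one] at this
    simp [e, this]
  have he3 : ∀ a, e a ^ 3 = 1 := by
    intro a
    rw [← map_pow, show a ^ 3 = 1 by revert a; decide, map_one]
  let ψ : Multiplicative (ZMod 3) × Multiplicative (ZMod 3) →* (Fin 3 → ℂˣ) :=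
    { toFun := fun x => ![e x.1, e x.2, 1]
      map_one' := by
        funext i
        fin_cases i <;> simp
      map_mul' := fun x y => by
        funext i
        fin_cases i <;> simp }
  let φ := diagonalAut.comp ψ
  have hφ : Function.Injective φ := by
    rw [injective_iff_map_eq_one]
    rintro ⟨a, b⟩ hab
    have h := eq_of_diagonalAut_eq_one hab
    have h0 : e a = 1 := h 0 2
    have h1 : e b = 1 := h 1 2
    rw [← map_one e] at h0 h1
    rw [he h0, he h1]
    rfl
  have hrange : φ.range = groupG ω := by
    apply le_antisymm
    · rintro _ ⟨x, rfl⟩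
      refine diagonalAut_mem_groupG hω fun i => ?_
      fin_cases i <;> simp [ψ, he3]
    · rw [groupG, Subgroup.closure_le]
      rintro x (rfl | rfl)
      · refine ⟨(Multiplicative.ofAdd 1, 1), ?_⟩
        change diagonalAut ![_, _, _] = _
        rw [he1, map_one]
        rfl
      · refine ⟨(1, Multiplicative.ofAdd 1), ?_⟩
        change diagonalAut ![_, _, _] = _
        rw [he1, map_one]
        rfl
  exact ⟨((MonoidHom.ofInjective hφ).trans (MulEquiv.subgroupCongr hrange)).symm⟩

lemma natCard_groupG {ω : ℂˣ} (hω : IsPrimitiveRoot ω 3) : Nat.card (groupG ω) = 9 := by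
  obtain ⟨e⟩ := exists_mulEquiv_groupG hω
  rw [Nat.card_congr e.toEquiv, Nat.card_prod, Nat.card_congr Multiplicative.toAdd, Nat.card_zmod]

lemma groupG'_le_normalizer {ω : ℂˣ} (hω : IsPrimitiveRoot ω 3) (γ : Equiv.Perm (Fin 3)) :
    groupG' ω γ ≤ Subgroup.normalizer (groupG ω) := by
  refine sup_le Subgroup.le_normalizer ?_
  have key : ∀ (σ : Equiv.Perm (Fin 3)) (x : PGL3), x ∈ groupG ω →
      permAutHom σ * x * (permAutHom σ)⁻¹ ∈ groupG ω := by
    intro σ x hx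
    obtain ⟨d, hd, rfl⟩ := exists_of_mem_groupG hω hx
    rw [permAutHom_mul_diagonalAut]
    exact diagonalAut_mem_groupG hω fun i => hd _
  rw [Subgroup.zpowers_le, Subgroup.mem_normalizer_iff]
  refine fun x => ⟨fun hx => key γ x hx, fun hx => ?_⟩
  have := key γ⁻¹ _ hx
  rw [← permAutHom_apply] at this
  simpa [mul_assoc] using this

lemma normal_groupG {ω : ℂˣ} (hω : IsPrimitiveRoot ω 3) (γ : Equiv.Perm (Fin 3)) :
    ((groupG ω).subgroupOf (groupG' ω γ)).Normal :=
  Subgroup.normal_subgroupOf_of_le_normalizer (groupG'_le_normalizer hω γ)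

/-- An automorphism that is both diagonal and a coordinate permutation is trivial, and normality of
`G` makes the product of the two subgroups all of their join. -/
lemma isComplement'_groupG {ω : ℂˣ} (hω : IsPrimitiveRoot ω 3) (γ : Equiv.Perm (Fin 3)) :
    Subgroup.IsComplement' ((groupG ω).subgroupOf (groupG' ω γ))
      ((Subgroup.zpowers (permAut γ)).subgroupOf (groupG' ω γ)) := by
  have := normal_groupG hω γ
  apply Subgroup.isComplement'_of_disjoint_and_mul_eq_univ
  · rw [Subgroup.disjoint_def]
    rintro ⟨x, hx⟩ h1 h2
    rw [Subgroup.mem_subgroupOf] at h1 h2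
    obtain ⟨d, -, hd⟩ := exists_of_mem_groupG hω h1
    obtain ⟨n, hn⟩ := h2
    have hn' : permAutHom (γ ^ n) = x := by rw [map_zpow]; exact hn
    have := (eq_of_diagonalAut_eq_permAutHom (hd.symm.trans hn'.symm)).1
    rw [this, map_one] at hn'
    exact Subtype.ext hn'.symm
  · rw [← Subgroup.normal_mul, groupG', ← Subgroup.subgroupOf_sup le_sup_left le_sup_right,
      Subgroup.subgroupOf_self, Subgroup.coe_top]

lemma natCard_groupG' {ω : ℂˣ} (hω : IsPrimitiveRoot ω 3) {γ : Equiv.Perm (Fin 3)}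
    (hγ : γ.IsThreeCycle) : Nat.card (groupG' ω γ) = 27 := by
  rw [← (isComplement'_groupG hω γ).card_mul_card, groupG',
    Nat.card_congr (Subgroup.subgroupOfEquivOfLe le_sup_left).toEquiv,
    Nat.card_congr (Subgroup.subgroupOfEquivOfLe le_sup_right).toEquiv, natCard_groupG hω,
    Nat.card_zpowers, ← permAutHom_apply, orderOf_injective _ permAutHom_injective, hγ.orderOf]

open scoped Pointwise in
lemma exists_of_mem_groupG' {ω : ℂˣ} (hω : IsPrimitiveRoot ω 3) {γ : Equiv.Perm (Fin 3)}
    {x : PGL3} (hx : x ∈ groupG' ω γ) : ∃ (d : Fin 3 → ℂˣ) (n : ℕ), (∀ i, d i ^ 3 = 1) ∧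
      x = diagonalAut d * permAutHom (γ ^ n) := by
  have h : (⟨x, hx⟩ : groupG' ω γ) ∈ ((groupG ω).subgroupOf (groupG' ω γ) : Set (groupG' ω γ)) *
      ((Subgroup.zpowers (permAut γ)).subgroupOf (groupG' ω γ) : Set (groupG' ω γ)) :=
    (isComplement'_groupG hω γ).mul_eq.symm ▸ Set.mem_univ _
  obtain ⟨y, hy, z, hz, hyz⟩ := h
  obtain ⟨d, hd, hd'⟩ := exists_of_mem_groupG hω hy
  obtain ⟨m, hm⟩ := hz
  obtain ⟨n, hn⟩ := mem_powers_iff_mem_zpowers.mpr (⟨m, rfl⟩ : γ ^ m ∈ Subgroup.zpowers γ)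
  refine ⟨d, n, hd, ?_⟩
  have hn' : γ ^ n = γ ^ m := hn
  rw [hn', map_zpow, ← hd']
  exact (congrArg Subtype.val hyz).symm.trans (congrArg (y.1 * ·) hm.symm)

lemma mul_mem_groupG' {ω : ℂˣ} (hω : IsPrimitiveRoot ω 3) (γ : Equiv.Perm (Fin 3))
    {d : Fin 3 → ℂˣ} (hd : ∀ i, d i ^ 3 = 1) (n : ℕ) :
    diagonalAut d * permAutHom (γ ^ n) ∈ groupG' ω γ := by
  refine mul_mem (Subgroup.mem_sup_left (diagonalAut_mem_groupG hω hd))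
    (Subgroup.mem_sup_right ?_)
  rw [map_pow]
  exact pow_mem (Subgroup.mem_zpowers _) n

/-! ### The orbit of `(1 : 1 : -α)`. -/

lemma monomialVector_ne_zero (d : Fin 3 → ℂˣ) (σ : Equiv.Perm (Fin 3)) {v : Fin 3 → ℂ}
    (hv : v ≠ 0) : (fun i => (d i : ℂ) * v (σ⁻¹ i)) ≠ 0 := by
  obtain ⟨i, hi⟩ := Function.ne_iff.mp hv
  exact Function.ne_iff.mpr ⟨σ i, by simpa using hi⟩

lemma diagonalAut_mul_permAutHom_smul_mk (d : Fin 3 → ℂˣ) (σ : Equiv.Perm (Fin 3))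
    {v : Fin 3 → ℂ} (hv : v ≠ 0) :
    (diagonalAut d * permAutHom σ) • (Projectivization.mk ℂ v hv : P2) =
      Projectivization.mk ℂ (fun i => (d i : ℂ) * v (σ⁻¹ i)) (monomialVector_ne_zero d σ hv) := by
  change (Matrix.ProjGenLinGroup.mk (diagonalGL d * permGL σ) : PGL3) • _ = _
  rw [Projectivization.PGL.mk_smul_mk, Projectivization.mk_eq_mk_iff']
  refine ⟨1, ?_⟩
  rw [one_smul]
  change _ = (diagonalGL d * permGL σ).1.mulVec v
  rw [Units.val_mul, ← Matrix.mulVec_mulVec, permGL_mulVec, diagonalGL_mulVec]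
  rfl

lemma isSextacticVector_monomial {d : Fin 3 → ℂˣ} (hd : ∀ i, d i ^ 3 = 1)
    (σ : Equiv.Perm (Fin 3)) {v : Fin 3 → ℂ} (hv : IsSextacticVector v) :
    IsSextacticVector fun i => (d i : ℂ) * v (σ⁻¹ i) := by
  have hd' : ∀ i, (d i : ℂ) ^ 3 = 1 := fun i => by
    rw [← Units.val_pow_eq_pow_val, hd, Units.val_one]
  obtain ⟨h1, h2, j, k, hjk, h3⟩ := hv
  refine ⟨?_, fun i => mul_ne_zero (d i).ne_zero (h2 _), σ j, σ k, by simpa using hjk, ?_⟩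
  · simp only [mul_pow, hd', one_mul]
    rw [← h1]
    exact Equiv.sum_comp σ⁻¹ fun i => v i ^ 3
  · simpa [mul_pow, hd'] using h3

lemma isSextacticVector_one_one_neg {α : ℂ} (hα : α ^ 3 = 2) :
    IsSextacticVector ![1, 1, -α] := by
  have h0 : α ≠ 0 := by
    rintro rfl
    norm_num at hα
  refine ⟨?_, ?_, 0, 1, by simp, by simp⟩
  · simp only [Fin.sum_univ_three, Matrix.cons_val]
    linear_combination -hα
  · intro j
    fin_cases j <;> simp [h0]

lemma exists_pow_apply_two {γ : Equiv.Perm (Fin 3)} (hγ : γ.IsThreeCycle) (l : Fin 3) :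
    ∃ n : ℕ, (γ ^ n) 2 = l := by
  have hs : γ.support = Finset.univ := by
    rw [← Finset.card_eq_iff_eq_univ, hγ.card_support, Fintype.card_fin]
  have hne : ∀ i, γ i ≠ i := fun i => by
    rw [← Equiv.Perm.mem_support, hs]
    exact Finset.mem_univ i
  exact hγ.isCycle.exists_pow_eq (hne 2) (hne l)

/-- A power of a cycle that fixes a point of the support is trivial, and a 3-cycle on three letters
has full support. -/
lemma pow_eq_one_of_apply_two {γ : Equiv.Perm (Fin 3)} (hγ : γ.IsThreeCycle) {n : ℕ}
    (h : (γ ^ n) 2 = 2) : γ ^ n = 1 := by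
  have hs : γ.support = Finset.univ := by
    rw [← Finset.card_eq_iff_eq_univ, hγ.card_support, Fintype.card_fin]
  have hne : γ 2 ≠ 2 := by
    rw [← Equiv.Perm.mem_support, hs]
    exact Finset.mem_univ _
  exact hγ.isCycle.pow_eq_one_iff.mpr ⟨2, hne, h⟩

lemma one_one_neg_pow_three {α : ℂ} (hα : α ^ 3 = 2) (i : Fin 3) :
    (![1, 1, -α] : Fin 3 → ℂ) i ^ 3 = if i = 2 then -2 else 1 := by
  fin_cases i
  · simp
  · simp
  · simp only [Fin.reduceFinMk, Matrix.cons_val, if_true]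
    linear_combination -hα

/-- Every sextactic vector is, up to scaling, a monomial image of `(1, 1, -α)`. -/
lemma exists_monomial_eq_of_isSextacticVector {γ : Equiv.Perm (Fin 3)} (hγ : γ.IsThreeCycle)
    {α : ℂ} (hα : α ^ 3 = 2) {v : Fin 3 → ℂ} (hv : IsSextacticVector v) :
    ∃ (d : Fin 3 → ℂˣ) (n : ℕ) (c : ℂ), (∀ i, d i ^ 3 = 1) ∧
      c • (fun i => (d i : ℂ) * (![1, 1, -α] : Fin 3 → ℂ) ((γ ^ n)⁻¹ i)) = v := by
  obtain ⟨hsum, hne, j, k, hjk, hv3⟩ := hv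
  obtain ⟨l, hlj, hlk, hl⟩ : ∃ l, l ≠ j ∧ l ≠ k ∧ (Finset.univ : Finset (Fin 3)) = {j, k, l} :=
    (by decide : ∀ j k : Fin 3, j ≠ k → ∃ l, l ≠ j ∧ l ≠ k ∧
      (Finset.univ : Finset (Fin 3)) = {j, k, l}) j k hjk
  rw [hl, Finset.sum_insert (by simp [hjk, hlj.symm]), Finset.sum_insert (by simp [hlk.symm]),
    Finset.sum_singleton] at hsum
  obtain ⟨n, hn⟩ := exists_pow_apply_two hγ l
  have hs := fun i => (isSextacticVector_one_one_neg hα).2.1 ((γ ^ n)⁻¹ i)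
  have hs3 := fun i => one_one_neg_pow_three hα ((γ ^ n)⁻¹ i)
  set s : Fin 3 → ℂ := fun i => (![1, 1, -α] : Fin 3 → ℂ) ((γ ^ n)⁻¹ i)
  have hs3' : ∀ i, s i ^ 3 = if i = l then -2 else 1 := by
    intro i
    simp only [s, hs3, Equiv.Perm.inv_eq_iff_eq, hn]
  -- After the exceptional entry of `s` is moved to `l`, the cubes of `v` and `s` are proportional,
  -- so the entrywise ratios `v i / (v j * s i)` are cube roots of unity.
  have key : ∀ i, v i ^ 3 = v j ^ 3 * s i ^ 3 := by
    intro i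
    have hi : i ∈ ({j, k, l} : Finset (Fin 3)) := hl ▸ Finset.mem_univ i
    rw [hs3']
    simp only [Finset.mem_insert, Finset.mem_singleton] at hi
    rcases hi with rfl | rfl | rfl
    · simp [hlj.symm]
    · simp [hlk.symm, hv3]
    · simp only [if_true]
      linear_combination hsum + hv3
  have hcs : ∀ i, v j * s i ≠ 0 := fun i => mul_ne_zero (hne j) (hs i)
  refine ⟨fun i => Units.mk0 (v i / (v j * s i)) (div_ne_zero (hne i) (hcs i)), n, v j, ?_, ?_⟩
  · intro i
    ext
    rw [Units.val_pow_eq_pow_val, Units.val_mk0, div_pow, mul_pow, ← key, Units.val_one,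
      div_self (pow_ne_zero 3 (hne i))]
  · funext i
    change v j * (v i / (v j * s i) * s i) = v i
    have : s i ≠ 0 := hs i
    have := hne j
    field_simp

/-- The cubes `(1, 1, -2)` single out the last coordinate even up to scaling, so the permutation
part fixes that index and is trivial; the diagonal part is then scalar. -/
lemma eq_one_of_smul_s₁_eq {ω : ℂˣ} (hω : IsPrimitiveRoot ω 3) {γ : Equiv.Perm (Fin 3)}
    (hγ : γ.IsThreeCycle) {α : ℂ} (hα : α ^ 3 = 2) {x : PGL3} (hx : x ∈ groupG' ω γ)
    (h : x • s₁ α = s₁ α) : x = 1 := by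
  obtain ⟨d, n, hd, rfl⟩ := exists_of_mem_groupG' hω hx
  have hd' : ∀ i, (d i : ℂ) ^ 3 = 1 := fun i => by
    rw [← Units.val_pow_eq_pow_val, hd, Units.val_one]
  rw [s₁, diagonalAut_mul_permAutHom_smul_mk, Projectivization.mk_eq_mk_iff'] at h
  obtain ⟨c, hc⟩ := h
  have hc3 : ∀ i, c ^ 3 * (if i = 2 then -2 else 1) = if i = (γ ^ n) 2 then -2 else 1 := by
    intro i
    have := congrArg (· ^ 3) (congrFun hc i)
    simpa only [Pi.smul_apply, smul_eq_mul, mul_pow, hd', one_mul, one_one_neg_pow_three hα,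
      Equiv.Perm.inv_eq_iff_eq] using this
  -- Otherwise `-2 c³ = 1` and `c³ = -2`, giving `4 = 1`.
  have h2 : (γ ^ n) 2 = 2 := by
    by_contra hne
    have e1 := hc3 2
    have e2 := hc3 ((γ ^ n) 2)
    rw [if_pos rfl, if_neg (Ne.symm hne)] at e1
    rw [if_neg hne, if_pos rfl] at e2
    have : (3 : ℂ) = 0 := by linear_combination e1 + 2 * e2
    norm_num at this
  have hn := pow_eq_one_of_apply_two hγ h2
  have hconst : d = fun _ => d 0 := by
    have hs := (isSextacticVector_one_one_neg hα).2.1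
    have : ∀ i, (d i : ℂ) = c := by
      intro i
      have := congrFun hc i
      rw [hn] at this
      exact (mul_right_cancel₀ (hs i) this).symm
    funext i
    exact Units.ext ((this i).trans (this 0).symm)
  rw [hn, map_one, mul_one, hconst, diagonalAut_const]

theorem setOf_isSextacticPoint_eq_orbit {ω : ℂˣ} (hω : IsPrimitiveRoot ω 3)
    {γ : Equiv.Perm (Fin 3)} (hγ : γ.IsThreeCycle) {α : ℂ} (hα : α ^ 3 = 2) :
    {p : P2 | IsSextacticPoint fermatCubic p} = MulAction.orbit (groupG' ω γ) (s₁ α) := by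
  ext p
  constructor
  · intro hp
    induction p using Projectivization.ind with
    | _ v hv =>
      obtain ⟨d, n, c, hd, rfl⟩ := exists_monomial_eq_of_isSextacticVector hγ hα
        ((isSextacticPoint_fermatCubic_mk_iff hv).mp hp)
      refine ⟨⟨_, mul_mem_groupG' hω γ hd n⟩, ?_⟩
      change (diagonalAut d * permAutHom (γ ^ n)) • s₁ α = _
      rw [s₁, diagonalAut_mul_permAutHom_smul_mk, eq_comm, Projectivization.mk_eq_mk_iff']
      exact ⟨c, rfl⟩
  · rintro ⟨⟨x, hx⟩, rfl⟩
    obtain ⟨d, n, hd, rfl⟩ := exists_of_mem_groupG' hω hx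
    change IsSextacticPoint fermatCubic ((diagonalAut d * permAutHom (γ ^ n)) • s₁ α)
    rw [s₁, diagonalAut_mul_permAutHom_smul_mk, isSextacticPoint_fermatCubic_mk_iff]
    exact isSextacticVector_monomial hd _ (isSextacticVector_one_one_neg hα)

lemma ncard_orbit_s₁ {ω : ℂˣ} (hω : IsPrimitiveRoot ω 3) {γ : Equiv.Perm (Fin 3)}
    (hγ : γ.IsThreeCycle) {α : ℂ} (hα : α ^ 3 = 2) :
    (MulAction.orbit (groupG' ω γ) (s₁ α)).ncard = 27 := by
  have hinj : Function.Injective fun x : groupG' ω γ => x • s₁ α := by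
    intro x y hxy
    have hxy' : x.1 • s₁ α = y.1 • s₁ α := hxy
    have h : (y.1⁻¹ * x.1) • s₁ α = s₁ α := by rw [mul_smul, hxy', inv_smul_smul]
    have := eq_one_of_smul_s₁_eq hω hγ hα (mul_mem (inv_mem y.2) x.2) h
    exact Subtype.ext (inv_mul_eq_one.mp this).symm
  rw [← natCard_groupG' hω hγ]
  exact Set.ncard_range_of_injective hinj

end PlaneCurve

theorem proposition4p2 (ω : ℂˣ) (hω : IsPrimitiveRoot ω 3) (γ : Equiv.Perm (Fin 3))
    (hγ : γ.IsThreeCycle) (α : ℝ) (hα : α ^ 3 = 2) :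
    -- `G` is isomorphic to `ℤ/3 × ℤ/3`
    Nonempty (PlaneCurve.groupG ω ≃* Multiplicative (ZMod 3) × Multiplicative (ZMod 3)) ∧
    -- `G'` is the semidirect product of `G` by the cyclic group of the 3-cycle, of order 27
    ((PlaneCurve.groupG ω).subgroupOf (PlaneCurve.groupG' ω γ)).Normal ∧
    Subgroup.IsComplement'
      ((PlaneCurve.groupG ω).subgroupOf (PlaneCurve.groupG' ω γ))
      ((Subgroup.zpowers (PlaneCurve.permAut γ)).subgroupOf (PlaneCurve.groupG' ω γ)) ∧
    Nat.card (PlaneCurve.groupG' ω γ) = 27 ∧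
    -- the sextactic points are exactly the `G'`-orbit of `s₁`, and there are 27 of them
    {p : PlaneCurve.P2 | PlaneCurve.IsSextacticPoint PlaneCurve.fermatCubic p} =
      MulAction.orbit (PlaneCurve.groupG' ω γ) (PlaneCurve.s₁ (α : ℂ)) ∧
    {p : PlaneCurve.P2 | PlaneCurve.IsSextacticPoint PlaneCurve.fermatCubic p}.ncard = 27 := by
  have hα' : (α : ℂ) ^ 3 = 2 := by exact_mod_cast hα
  have horbit := PlaneCurve.setOf_isSextacticPoint_eq_orbit hω hγ hα'
  exact ⟨PlaneCurve.exists_mulEquiv_groupG hω, PlaneCurve.normal_groupG hω γ,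
    PlaneCurve.isComplement'_groupG hω γ, PlaneCurve.natCard_groupG' hω hγ, horbit,
    horbit ▸ PlaneCurve.ncard_orbit_s₁ hω hγ hα'⟩
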